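/- Let $(X,\mathcal F)$ be a dual pair of complex Banach spaces: there is a bilinear pairing $\langle\cdot,\cdot\rangle\colon X\times\mathcal F\to\mathbb C$ with $\|x\|=\sup_{\|\varphi\|\le 1}|\langle x,\varphi\rangle|$ and $\|\varphi\|=\sup_{\|x\|\le 1}|\langle x,\varphi\rangle|$ for all $x\in X$, $\varphi\in\mathcal F$. Let $\sigma(X,\mathcal F)$ be the weakest topology on $X$ making all $x\mapsto\langle x,\varphi\rangle$ continuous; $X\times X$ carries the product topology and its subspaces the induced one, also denoted $\sigma(X,\mathcal F)$. Assume that $(X,\mathcal F)$ and $(\mathcal F,X)$ have the Krein property, where $(X,\mathcal F)$ has the Krein property if the $\sigma(X,\mathcal F)$-closed convex hull of every $\sigma(X,\mathcal F)$-compact subset of $X$ is $\sigma(X,\mathcal F)$-compact. Let $U=(U_t)_{t\in\mathbb R}$ be a one-parameter group of $\sigma(X,\mathcal F)$-continuous linear isometries of $X$ such that $t\mapsto U_tx$ is $\sigma(X,\mathcal F)$-continuous for every $x\in X$. Its analytic generator $U_i$ is the linear operator in $X$ whose graph consists of all $(x,y)\in X\times X$ for which there is a $\sigma(X,\mathcal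 F)$-continuous function $f\colon\{w\in\mathbb C: 0\le\operatorname{Im}w\le1\}\to X$, holomorphic in the interior of the strip, with $f(t)=U_tx$ for all $t\in\mathbb R$ and $f(i)=y$. The ampliation of $U_i$ onto its graph is the operator $\Delta$ in $\mathrm{Graph}(U_i)\subset X\times X$ with $$D(\Delta)=\{(x,x')\in\mathrm{Graph}(U_i): x,x'\in D(U_i)\},\qquad \Delta(x,x')=(U_ix,U_ix').$$ Let $\mu\in\mathbb C\setminus(-\infty,0]$ and $$F_\mu(t)=\frac1{2\pi}\int_{-\infty}^{\infty}\frac{e^{E(1+it)}}{(e^E+\mu)^2}\,dE\qquad(t\in\mathbb R).$$ Then there is a bounded $\sigma(X,\mathcal F)$-continuous linear operator $Q_\mu$ on $X$ given by $Q_\mu x=\int_{\mathbb R}F_\mu(t)U_tx\,dt$, that is, for all $x\in X$ and $\varphi\in\mathcal F$ the function $t\mapsto F_\mu(t)\langle U_tx,\varphi\rangle$ is integrable and $\langle Q_\mu x,\varphi\rangle=\int_{\mathbb R}F_\mu(t)\langle U_tx,\varphi\rangle\,dt$. The operator matrix $$\begin{pmatrix}-Q_\mu+\frac1\mu I&-\frac1\mu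 Q_\mu\\ \mu Q_\mu&Q_\mu\end{pmatrix}$$ on $X\times X$ maps $\mathrm{Graph}(U_i)$ into itself, and its restriction $R_\mu$ to $\mathrm{Graph}(U_i)$ is a bounded $\sigma(X,\mathcal F)$-continuous operator which is the resolvent of $\Delta$ at $-\mu$: 1. $R_\mu(\Delta+\mu I)p=p$ for every $p\in D(\Delta)$; 2. for every $p\in\mathrm{Graph}(U_i)$, $R_\mu p\in D(\Delta)$ and $(\Delta+\mu I)R_\mu p=p$. -/

import Mathlib

open Complex MeasureTheory Topology

noncomputable section

namespace AnalyticGenerator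

section DualPair

variable {X F : Type*} [NormedAddCommGroup X] [NormedSpace ℂ X]
  [NormedAddCommGroup F] [NormedSpace ℂ F]

/-- The topology `σ(X, F)` on `X`: the weakest one making all `x ↦ ⟨x, φ⟩` continuous. -/
@[reducible] def weakTopology (B : X →ₗ[ℂ] F →ₗ[ℂ] ℂ) : TopologicalSpace X :=
  inferInstanceAs (TopologicalSpace (WeakBilin B))

/-- The product topology `σ(X, F) × σ(X, F)` on `X × X`. -/
@[reducible] def weakTopologyProd (B : X →ₗ[ℂ] F →ₗ[ℂ] ℂ) : TopologicalSpace (X × X) :=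
  @instTopologicalSpaceProd X X (weakTopology B) (weakTopology B)

/-- The topology induced by `σ(X, F)` on a linear subspace of `X × X`. -/
@[reducible] def weakTopologySub (B : X →ₗ[ℂ] F →ₗ[ℂ] ℂ) (G : Submodule ℂ (X × X)) : TopologicalSpace G :=
  TopologicalSpace.induced Subtype.val (weakTopologyProd B)

/-- `(X, F)` is a dual pair of normed spaces for the pairing `B`: each of the two norms is
the dual norm of the other one. -/
structure IsDualPair (B : X →ₗ[ℂ] F →ₗ[ℂ] ℂ) : Prop where
  norm_left : ∀ x : X, IsLUB {r : ℝ | ∃ φ : F, ‖φ‖ ≤ 1 ∧ r = ‖B x φ‖} ‖x‖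
  norm_right : ∀ φ : F, IsLUB {r : ℝ | ∃ x : X, ‖x‖ ≤ 1 ∧ r = ‖B x φ‖} ‖φ‖

/-- The Krein property of `(X, F)`: the `σ(X, F)`-closed convex hull of every
`σ(X, F)`-compact set is `σ(X, F)`-compact. -/
def KreinProperty (B : X →ₗ[ℂ] F →ₗ[ℂ] ℂ) : Prop :=
  ∀ K : Set X, @IsCompact X (weakTopology B) K →
    @IsCompact X (weakTopology B) (closure[weakTopology B] (convexHull ℝ K))

/-- `U` is a `σ(X, F)`-continuous one-parameter group of isometries in `B_F(X)`, the
`σ(X, F)`-continuous bounded operators on `X`. -/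
structure IsIsometryGroup (B : X →ₗ[ℂ] F →ₗ[ℂ] ℂ) (U : ℝ → X →L[ℂ] X) : Prop where
  map_zero : U 0 = ContinuousLinearMap.id ℂ X
  map_add : ∀ s t : ℝ, U (s + t) = (U s).comp (U t)
  isometry : ∀ (t : ℝ) (x : X), ‖U t x‖ = ‖x‖
  weak_continuous : ∀ t : ℝ, Continuous[weakTopology B, weakTopology B] (U t)
  continuous_orbit : ∀ x : X, Continuous[inferInstance, weakTopology B] (fun t : ℝ => U t x)

theorem weakTopology_pairing_comp {B : X →ₗ[ℂ] F →ₗ[ℂ] ℂ} {f : ℂ → X} {s : Set ℂ}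
    (hf : @ContinuousOn ℂ X _ (weakTopology B) f s) (φ : F) :
    ContinuousOn (fun w => B (f w) φ) s :=
  @Continuous.comp_continuousOn ℂ X ℂ _ (weakTopology B) _ _ _ _
    (WeakBilin.eval_continuous B φ) hf

end DualPair

section Generator

variable {X F : Type*} [NormedAddCommGroup X] [NormedSpace ℂ X]
  [NormedAddCommGroup F] [NormedSpace ℂ F]

/-- The closed strip between the real axis and the horizontal line through `z`. -/
def strip (z : ℂ) : Set ℂ := {w | 0 ≤ w.im * z.im ∧ |w.im| ≤ |z.im|}

/-- `f` is a `σ(X, F)`-continuous function on the strip of `z`, holomorphic inside the strip,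
that extends the orbit `t ↦ U_t x`. -/
structure IsStripExtension (B : X →ₗ[ℂ] F →ₗ[ℂ] ℂ) (U : ℝ → X →L[ℂ] X) (z : ℂ) (x : X)
    (f : ℂ → X) : Prop where
  continuousOn : @ContinuousOn ℂ X _ (weakTopology B) f (strip z)
  differentiableOn : DifferentiableOn ℂ f (interior (strip z))
  apply_ofReal : ∀ t : ℝ, f t = U t x

/-- The set of pairs `(x, y)` such that `y` is the value at `z` of an extension of the orbit
of `x` to the strip of `z`. -/
def extensionGraph (B : X →ₗ[ℂ] F →ₗ[ℂ] ℂ) (U : ℝ → X →L[ℂ] X) (z : ℂ) :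
    Submodule ℂ (X × X) where
  carrier := {p | ∃ f : ℂ → X, IsStripExtension B U z p.1 f ∧ f z = p.2}
  zero_mem' := ⟨fun _ => 0,
    ⟨@continuousOn_const ℂ X _ (weakTopology B) _ _, differentiableOn_const 0, by simp⟩, rfl⟩
  add_mem' := by
    rintro p q ⟨f, hf, hfz⟩ ⟨g, hg, hgz⟩
    refine ⟨fun w => f w + g w, ⟨?_, hf.2.add hg.2, ?_⟩, by simp [hfz, hgz]⟩
    · exact @ContinuousOn.add (WeakBilin B) _ _ _ ℂ _ f g _ hf.1 hg.1
    · intro t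
      simp [hf.3 t, hg.3 t]
  smul_mem' := by
    rintro c p ⟨f, hf, hfz⟩
    refine ⟨fun w => c • f w, ⟨?_, hf.2.const_smul c, ?_⟩, by simp [hfz]⟩
    · exact @ContinuousOn.smul ℂ (WeakBilin B) ℂ _ _ _ _ _ (fun _ => c) f _
        continuousOn_const hf.1
    · intro t
      simp [hf.3 t]

/-- The operator `U_z`, the one whose graph is `extensionGraph B U z`
(see `graph_complexPower`). -/
def complexPower (B : X →ₗ[ℂ] F →ₗ[ℂ] ℂ) (U : ℝ → X →L[ℂ] X) (z : ℂ) : X →ₗ.[ℂ] X :=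
  (extensionGraph B U z).toLinearPMap

/-- The analytic generator `U_i`. -/
def analyticGenerator (B : X →ₗ[ℂ] F →ₗ[ℂ] ℂ) (U : ℝ → X →L[ℂ] X) : X →ₗ.[ℂ] X :=
  complexPower B U I

/-- The ampliation `Δ` of an operator `T` onto its graph: `Δ (x, x') = (T x, T x')` for those
`(x, x')` in the graph of `T` for which `x` and `x'` lie in the domain of `T`. -/
def ampliation (T : X →ₗ.[ℂ] X) : T.graph →ₗ.[ℂ] T.graph where
  domain :=
    { carrier := {p | (p : X × X).1 ∈ T.domain ∧ (p : X × X).2 ∈ T.domain}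
      zero_mem' := ⟨T.domain.zero_mem, T.domain.zero_mem⟩
      add_mem' := fun hp hq => ⟨T.domain.add_mem hp.1 hq.1, T.domain.add_mem hp.2 hq.2⟩
      smul_mem' := fun c _ hp => ⟨T.domain.smul_mem c hp.1, T.domain.smul_mem c hp.2⟩ }
  toFun :=
    { toFun := fun p =>
        ⟨(T ⟨(p.1 : X × X).1, p.2.1⟩, T ⟨(p.1 : X × X).2, p.2.2⟩), by
          obtain ⟨y, hy, hy'⟩ := (LinearPMap.mem_graph_iff T).1 p.1.2
          have h : (⟨(p.1 : X × X).1, p.2.1⟩ : T.domain) = y := Subtype.ext hy.symm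
          rw [h, hy']
          exact T.mem_graph ⟨(p.1 : X × X).2, p.2.2⟩⟩
      map_add' := fun p q =>
        Subtype.ext (Prod.ext
          (T.map_add ⟨(p.1 : X × X).1, p.2.1⟩ ⟨(q.1 : X × X).1, q.2.1⟩)
          (T.map_add ⟨(p.1 : X × X).2, p.2.2⟩ ⟨(q.1 : X × X).2, q.2.2⟩))
      map_smul' := fun c p =>
        Subtype.ext (Prod.ext
          (T.map_smul c ⟨(p.1 : X × X).1, p.2.1⟩)
          (T.map_smul c ⟨(p.1 : X × X).2, p.2.2⟩)) }

end Generator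

section SingleValued

/-- A continuous function on the closed strip `0 ≤ Im w ≤ h`, holomorphic inside it, that
vanishes on the real axis vanishes at every point of height at most `h / 2`. -/
theorem eq_zero_of_le_half {g : ℂ → ℂ} {h : ℝ}
    (hc : ContinuousOn g {w | 0 ≤ w.im ∧ w.im ≤ h})
    (hd : DifferentiableOn ℂ g {w | 0 < w.im ∧ w.im < h})
    (h0 : ∀ t : ℝ, g t = 0) {c : ℂ} (hc0 : 0 < c.im) (hch : c.im ≤ h / 2) : g c = 0 := by
  have hreal : ∀ w : ℂ, w.im = 0 → g w = 0 := by
    intro w hw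
    have : w = (w.re : ℂ) := Complex.ext (by simp) (by simp [hw])
    rw [this]
    exact h0 _
  set r := c.im with hr
  set S : Set ℂ := Set.Ioo (-r) r ×ℂ Set.Ioo (-r) r with hS
  have hneg : -r < r := by linarith
  have hcl : closure S = Set.Icc (-r) r ×ℂ Set.Icc (-r) r := by
    rw [hS, Complex.closure_reProdIm, closure_Ioo hneg.ne]
  have hopen : IsOpen {w : ℂ | 0 < w.im ∧ w.im < h} :=
    (isOpen_lt continuous_const Complex.continuous_im).inter
      (isOpen_lt Complex.continuous_im continuous_const)
  -- each rotated copy of `g` is continuous on the closed square and holomorphic inside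
  have key : ∀ u : ℂ, (∀ w ∈ S, |(u * w).im| < r) → (∀ w ∈ closure S, |(u * w).im| ≤ r) →
      DiffContOnCl ℂ (fun w => g (c + u * w)) S := by
    intro u h1 h2
    have hcont : Continuous fun w : ℂ => c + u * w := by fun_prop
    have hdiff : Differentiable ℂ fun w : ℂ => c + u * w := by fun_prop
    refine ⟨hd.comp hdiff.differentiableOn ?_, hc.comp hcont.continuousOn ?_⟩
    · intro w hw
      have := abs_lt.1 (h1 w hw)
      simp only [Set.mem_ofPred_eq, Complex.add_im]
      constructor <;> linarith [this.1, this.2]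
    · intro w hw
      have := abs_le.1 (h2 w hw)
      simp only [Set.mem_ofPred_eq, Complex.add_im]
      constructor <;> linarith [this.1, this.2]
  have hSm : ∀ w ∈ S, |w.re| < r ∧ |w.im| < r := fun w hw =>
    ⟨abs_lt.2 ⟨hw.1.1, hw.1.2⟩, abs_lt.2 ⟨hw.2.1, hw.2.2⟩⟩
  have hSc : ∀ w ∈ closure S, |w.re| ≤ r ∧ |w.im| ≤ r := fun w hw => by
    rw [hcl] at hw
    exact ⟨abs_le.2 ⟨hw.1.1, hw.1.2⟩, abs_le.2 ⟨hw.2.1, hw.2.2⟩⟩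
  have k1 := key 1 (fun w hw => by simpa using (hSm w hw).2)
    (fun w hw => by simpa using (hSc w hw).2)
  have k2 := key (-1) (fun w hw => by simpa using (hSm w hw).2)
    (fun w hw => by simpa using (hSc w hw).2)
  have k3 := key I (fun w hw => by simpa using (hSm w hw).1)
    (fun w hw => by simpa using (hSc w hw).1)
  have k4 := key (-I) (fun w hw => by simpa using (hSm w hw).1)
    (fun w hw => by simpa using (hSc w hw).1)
  have hP := ((k1.smul k2).smul k3).smul k4
  have hb : Bornology.IsBounded S := (Metric.isBounded_Ioo _ _).reProdIm (Metric.isBounded_Ioo _ _)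
  have hz : (0 : ℂ) ∈ closure S := by
    rw [hcl]
    exact ⟨⟨by simp; linarith, by simp; linarith⟩, ⟨by simp; linarith, by simp; linarith⟩⟩
  have := Complex.norm_le_of_forall_mem_frontier_norm_le (C := 0) hb hP (fun w hw => ?_) hz
  · have h4 : ‖g c‖ * ‖g c‖ * ‖g c‖ * ‖g c‖ ≤ 0 := by simpa using this
    have h5 : ‖g c‖ ^ 4 = 0 := le_antisymm (by ring_nf at h4 ⊢; exact h4) (by positivity)
    exact norm_eq_zero.1 ((pow_eq_zero_iff (by norm_num)).1 h5)
  · rw [hS, Complex.frontier_reProdIm, frontier_Ioo hneg, closure_Ioo hneg.ne] at hw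
    rw [norm_le_zero_iff]
    rcases hw with ⟨-, hw⟩ | ⟨hw, -⟩ <;> rcases hw with hw | hw
    · simp only [smul_eq_mul, mul_eq_zero]
      exact Or.inl (Or.inl (Or.inl (hreal _ (by simp [← hr, hw]))))
    · simp only [smul_eq_mul, mul_eq_zero]
      exact Or.inl (Or.inl (Or.inr (hreal _ (by simp [← hr, show w.im = r from hw]))))
    · simp only [smul_eq_mul, mul_eq_zero]
      exact Or.inl (Or.inr (hreal _ (by simp [← hr, hw])))
    · simp only [smul_eq_mul, mul_eq_zero]
      exact Or.inr (hreal _ (by simp [← hr, show w.re = r from hw]))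

theorem eq_zero_of_strip {g : ℂ → ℂ} {h : ℝ} (hh : 0 < h)
    (hc : ContinuousOn g {w | 0 ≤ w.im ∧ w.im ≤ h})
    (hd : DifferentiableOn ℂ g {w | 0 < w.im ∧ w.im < h})
    (h0 : ∀ t : ℝ, g t = 0) {c : ℂ} (hcs : c.im = h) : g c = 0 := by
  have hopen : IsOpen {w : ℂ | 0 < w.im ∧ w.im < h} :=
    (isOpen_lt continuous_const Complex.continuous_im).inter
      (isOpen_lt Complex.continuous_im continuous_const)
  have hconv : Convex ℝ {w : ℂ | 0 < w.im ∧ w.im < h} :=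
    (convex_halfSpace_im_gt 0).inter (convex_halfSpace_im_lt h)
  have hm : ((h / 4 : ℝ) : ℂ) * I ∈ {w : ℂ | 0 < w.im ∧ w.im < h} := by
    simp only [Set.mem_ofPred_eq, Complex.mul_im, Complex.ofReal_re, Complex.ofReal_im,
      Complex.I_re, Complex.I_im]
    constructor <;> linarith
  have hev : g =ᶠ[𝓝 (((h / 4 : ℝ) : ℂ) * I)] (fun _ => (0 : ℂ)) := by
    have hopen2 : IsOpen {w : ℂ | 0 < w.im ∧ w.im < h / 2} :=
      (isOpen_lt continuous_const Complex.continuous_im).inter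
        (isOpen_lt Complex.continuous_im continuous_const)
    refine Filter.eventuallyEq_of_mem (hopen2.mem_nhds ?_)
      (fun w hw => eq_zero_of_le_half hc hd h0 hw.1 hw.2.le)
    simp only [Set.mem_ofPred_eq, Complex.mul_im, Complex.ofReal_re, Complex.ofReal_im,
      Complex.I_re, Complex.I_im]
    constructor <;> linarith
  have hin : Set.EqOn g (fun _ => (0 : ℂ)) {w : ℂ | 0 < w.im ∧ w.im < h} :=
    (hd.analyticOnNhd hopen).eqOn_of_preconnected_of_eventuallyEq analyticOnNhd_const
      hconv.isPreconnected hm hev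
  -- approach `c` vertically from below
  have hmaps : ∀ s ∈ Set.Ioo (0 : ℝ) h, g (c - s * I) = 0 := fun s hs =>
    hin (by
      simp only [Set.mem_ofPred_eq, Complex.sub_im, Complex.mul_im, Complex.ofReal_re,
        Complex.ofReal_im, Complex.I_re, Complex.I_im, hcs]
      constructor <;> linarith [hs.1, hs.2])
  have hcont : ContinuousOn (fun s : ℝ => g (c - s * I)) (Set.Icc 0 h) := by
    refine hc.comp (by fun_prop) (fun s hs => ?_)
    simp only [Set.mem_ofPred_eq, Complex.sub_im, Complex.mul_im, Complex.ofReal_re,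
      Complex.ofReal_im, Complex.I_re, Complex.I_im, hcs]
    constructor <;> linarith [hs.1, hs.2]
  have heq : Set.EqOn (fun s : ℝ => g (c - s * I)) (fun _ => (0 : ℂ)) (Set.Icc 0 h) :=
    Set.EqOn.of_subset_closure hmaps hcont continuousOn_const Set.Ioo_subset_Icc_self
      (by rw [closure_Ioo hh.ne])
  simpa using heq (Set.left_mem_Icc.2 hh.le)

variable {X F : Type*} [NormedAddCommGroup X] [NormedSpace ℂ X]
  [NormedAddCommGroup F] [NormedSpace ℂ F]

theorem IsDualPair.eq_zero {B : X →ₗ[ℂ] F →ₗ[ℂ] ℂ} (hB : IsDualPair B) {x : X}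
    (hx : ∀ φ, B x φ = 0) : x = 0 := by
  have : ‖x‖ ≤ 0 := (hB.norm_left x).2 (by
    rintro r ⟨φ, -, rfl⟩
    simp [hx φ])
  exact norm_le_zero_iff.1 this

theorem IsDualPair.norm_pairing_le {B : X →ₗ[ℂ] F →ₗ[ℂ] ℂ} (hB : IsDualPair B) (φ : F) :
    ∀ x : X, ‖B x φ‖ ≤ ‖φ‖ * ‖x‖ := by
  intro x
  rcases eq_or_ne x 0 with rfl | hx
  · simp
  have hx' : 0 < ‖x‖ := norm_pos_iff.2 hx
  have := (hB.norm_right φ).1 ⟨((‖x‖⁻¹ : ℝ) : ℂ) • x, by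
    rw [norm_smul, Complex.norm_real, norm_inv, norm_norm, inv_mul_cancel₀ hx'.ne'], rfl⟩
  rw [map_smul, LinearMap.smul_apply, norm_smul, Complex.norm_real, norm_inv, norm_norm,
    inv_mul_le_iff₀ hx'] at this
  linarith

/-- The extension of an orbit to a strip is unique: `U_z` is single-valued. -/
theorem extensionGraph_single_valued {B : X →ₗ[ℂ] F →ₗ[ℂ] ℂ} (hB : IsDualPair B)
    (U : ℝ → X →L[ℂ] X) (z : ℂ) (p : X × X) (hp : p ∈ extensionGraph B U z)
    (hp0 : p.1 = 0) : p.2 = 0 := by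
  obtain ⟨f, hf, hfz⟩ := hp
  rw [← hfz]
  refine hB.eq_zero fun φ => ?_
  have h0 : ∀ t : ℝ, B (f t) φ = 0 := fun t => by simp [hf.3 t, hp0]
  have hc : ContinuousOn (fun w => B (f w) φ) (strip z) := weakTopology_pairing_comp hf.1 φ
  have hd : DifferentiableOn ℂ (fun w => B (f w) φ) (interior (strip z)) := by
    have hL := ((B.flip φ).mkContinuous ‖φ‖ (hB.norm_pairing_le φ)).differentiable
    exact hL.comp_differentiableOn hf.2
  rcases lt_trichotomy z.im 0 with hz | hz | hz
  · have h1 : Set.MapsTo (fun w : ℂ => -w) {w | 0 ≤ w.im ∧ w.im ≤ -z.im} (strip z) := by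
      rintro w ⟨hw1, hw2⟩
      refine ⟨?_, ?_⟩
      · simp only [Complex.neg_im]
        nlinarith
      · rw [Complex.neg_im, abs_neg, abs_of_nonneg hw1, abs_of_neg hz]
        exact hw2
    have hopen : IsOpen {w : ℂ | z.im < w.im ∧ w.im < 0} :=
      (isOpen_lt continuous_const Complex.continuous_im).inter
        (isOpen_lt Complex.continuous_im continuous_const)
    have h2 : {w : ℂ | z.im < w.im ∧ w.im < 0} ⊆ interior (strip z) := by
      refine interior_maximal ?_ hopen
      rintro w ⟨hw1, hw2⟩
      refine ⟨by nlinarith, ?_⟩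
      rw [abs_of_neg hw2, abs_of_neg hz]
      linarith
    have := eq_zero_of_strip (g := fun w => B (f (-w)) φ) (h := -z.im) (c := -z) (by linarith)
      (hc.comp continuous_neg.continuousOn h1)
      (hd.comp differentiable_neg.differentiableOn (fun w hw => h2 (by
        simp only [Set.mem_ofPred_eq, Complex.neg_im]
        constructor <;> linarith [hw.1, hw.2])))
      (fun t => by simpa using h0 (-t)) (by simp)
    simpa using this
  · have : z = (z.re : ℂ) := Complex.ext (by simp) (by simp [hz])
    rw [this]
    exact h0 _
  · have h1 : {w : ℂ | 0 ≤ w.im ∧ w.im ≤ z.im} ⊆ strip z := by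
      rintro w ⟨hw1, hw2⟩
      refine ⟨by positivity, ?_⟩
      rw [abs_of_nonneg hw1, abs_of_pos hz]
      exact hw2
    have hopen : IsOpen {w : ℂ | 0 < w.im ∧ w.im < z.im} :=
      (isOpen_lt continuous_const Complex.continuous_im).inter
        (isOpen_lt Complex.continuous_im continuous_const)
    have h2 : {w : ℂ | 0 < w.im ∧ w.im < z.im} ⊆ interior (strip z) :=
      interior_maximal (fun w hw => h1 ⟨hw.1.le, hw.2.le⟩) hopen
    exact eq_zero_of_strip (g := fun w => B (f w) φ) hz (hc.mono h1) (hd.mono h2) h0 rfl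

theorem graph_complexPower {B : X →ₗ[ℂ] F →ₗ[ℂ] ℂ} (hB : IsDualPair B)
    (U : ℝ → X →L[ℂ] X) (z : ℂ) : (complexPower B U z).graph = extensionGraph B U z :=
  Submodule.toLinearPMap_graph_eq _ (extensionGraph_single_valued hB U z)

end SingleValued

section Resolvent

variable {X F : Type*} [NormedAddCommGroup X] [NormedSpace ℂ X]
  [NormedAddCommGroup F] [NormedSpace ℂ F]

/-- The function `F_μ(t) = (1 / 2π) ∫ e^{E (1 + it)} / (e^E + μ)² dE`. -/
def kernelF (μ : ℂ) (t : ℝ) : ℂ :=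
  (1 / (2 * Real.pi)) * ∫ E : ℝ, exp (E * (1 + I * t)) / (exp E + μ) ^ 2

/-- `y = ∫ f(t) dt`, the integral being taken weakly against all elements of `F`. -/
def IsWeakIntegral (B : X →ₗ[ℂ] F →ₗ[ℂ] ℂ) (f : ℝ → X) (y : X) : Prop :=
  ∀ φ : F, Integrable (fun t => B (f t) φ) ∧ B y φ = ∫ t, B (f t) φ

/-- The operator matrix
`((-Q + μ⁻¹ I, -μ⁻¹ Q), (μ Q, Q))` acting on the Banach space `X × X`. -/
def resolventMatrix (μ : ℂ) (Q : X →L[ℂ] X) : X × X →L[ℂ] X × X :=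
  ((-Q + μ⁻¹ • ContinuousLinearMap.id ℂ X).coprod (-(μ⁻¹ • Q))).prod ((μ • Q).coprod Q)

end Resolvent

end AnalyticGenerator

end

open AnalyticGenerator

namespace AnalyticGenerator

/-! ### Exponential bounds and functional equations for the kernels -/

section Kernel

/-! Write T = U_i and, formally, U_t = T^{-it}. The kernel F_μ is the inverse Fourier transform of
g(E) = e^E/(e^E + μ)², so Q_μ stands for T(T + μ)^{-2}. For (x, y) in the graph of T, the vector s =
Q_μ(μx + y) then stands for (T + μ)^{-1}y, and x - s = μ(T + μ)^{-1}x. The factor T + μ, available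
on the graph, replaces the symbol u(E) = 1/(e^E + μ), which is not integrable, by the integrable g =
-u'. Everything rests on the rigorous form of this: s ∈ D(T) and Ts = y - μs
(`mem_extensionGraph_resolvent`).

Let k extend F_μ holomorphically to |Im ζ| < 1, and let r be the inverse Fourier transform of u on
-1 < Im ζ < 0. There k(ζ) = iζ r(ζ) and k(ζ) + μ k(ζ + i) = r(ζ). These two relations make r a
Cauchy kernel for the strip: f(w) = ∫ r(t - w)(μ f(t) + f(t + i)) dt for bounded f, holomorphic
inside and continuous up to the boundary (`integral_resolventKernel_mul_eq`).

Put v = μx + y and H(w) = ∫ k(t - w) U_t v dt for |Im w| < 1. Then H extends the orbit of s. If f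
extends the orbit of x, then U_t v = μ f(t) + f(t + i), and the Cauchy formula reads H(w) + μ H(w -
i) = f(w) for 0 < Im w < 1. Thus f(w) - μ H(w - i) continues H up to Im w = 1, with value y - μs at
i. Applied to y = -μx, the same statement shows that T + μ is injective; the two resolvent
identities are then linear algebra.

The vector integrals exist weakly by the Krein property of (X, F). That of (F, X) gives the
transpose of Q_μ, hence its weak continuity. -/

theorem integrable_exp_neg_mul_abs {δ : ℝ} (hδ : 0 < δ) :
    Integrable fun E : ℝ => Real.exp (-(δ * |E|)) := by
  refine ((integrable_inv_one_add_sq.const_mul (1 + 2 / δ ^ 2))).mono'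
    (by fun_prop) (Filter.Eventually.of_forall fun E => ?_)
  rw [Real.norm_eq_abs, Real.abs_exp, Real.exp_neg, ← div_eq_mul_inv, inv_eq_one_div,
    div_le_div_iff₀ (Real.exp_pos _) (by positivity)]
  have h := Real.quadratic_le_exp_of_nonneg (x := δ * |E|) (by positivity)
  have h2 : (δ * |E|) ^ 2 = δ ^ 2 * E ^ 2 := by rw [mul_pow, sq_abs]
  have h3 : 0 ≤ δ * |E| := by positivity
  have h4 : 1 + δ ^ 2 * E ^ 2 / 2 ≤ Real.exp (δ * |E|) := by rw [h2] at h; linarith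
  calc 1 * (1 + E ^ 2) ≤ (1 + 2 / δ ^ 2) * (1 + δ ^ 2 * E ^ 2 / 2) := by
        have : (1 + 2 / δ ^ 2) * (1 + δ ^ 2 * E ^ 2 / 2)
            = 1 + E ^ 2 + 2 / δ ^ 2 + δ ^ 2 * E ^ 2 / 2 := by field_simp; ring
        rw [this]
        have : 0 ≤ 2 / δ ^ 2 + δ ^ 2 * E ^ 2 / 2 := by positivity
        linarith
    _ ≤ _ := by gcongr

/-- The function `E ↦ 1 / (e^E + μ)`. -/
noncomputable def resolventSymbol (μ : ℂ) (E : ℝ) : ℂ := (exp E + μ)⁻¹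

/-- The function `E ↦ e^E / (e^E + μ)²`, minus the derivative of `resolventSymbol μ`. -/
noncomputable def kernelSymbol (μ : ℂ) (E : ℝ) : ℂ :=
  resolventSymbol μ E * (1 - μ * resolventSymbol μ E)

/-- The extension of `kernelF μ` to complex arguments. -/
noncomputable def kernelExt (μ ζ : ℂ) : ℂ :=
  (1 / (2 * Real.pi)) * ∫ E : ℝ, exp (I * ζ * E) * kernelSymbol μ E

/-- The inverse Fourier transform of `resolventSymbol μ` at complex arguments. -/
noncomputable def resolventKernel (μ ζ : ℂ) : ℂ :=
  (1 / (2 * Real.pi)) * ∫ E : ℝ, exp (I * ζ * E) * resolventSymbol μ E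

variable {μ : ℂ}

/-- After division by 1 + e^E the quantity is a point of the segment from μ to 1. The slit plane is
star-shaped about 1, so this compact segment stays away from 0. -/
theorem exists_le_norm_exp_add (hμ : μ ∈ slitPlane) :
    ∃ c : ℝ, 0 < c ∧ ∀ E : ℝ, c * (1 + Real.exp E) ≤ ‖exp E + μ‖ := by
  have hne : ∀ t ∈ Set.Icc (0 : ℝ) 1, (0 : ℝ) < ‖(t : ℂ) + (1 - t : ℝ) * μ‖ := by
    intro t ht
    rw [norm_pos_iff]
    have := starConvex_one_slitPlane hμ ht.1 (by linarith [ht.2] : (0 : ℝ) ≤ 1 - t) (by ring)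
    have h2 := slitPlane_ne_zero this
    simpa using h2
  have hcont : ContinuousOn (fun t : ℝ => ‖(t : ℂ) + (1 - t : ℝ) * μ‖) (Set.Icc 0 1) := by
    fun_prop
  obtain ⟨t0, ht0, hmin⟩ := isCompact_Icc.exists_isMinOn (Set.nonempty_Icc.2 zero_le_one) hcont
  refine ⟨_, hne t0 ht0, fun E => ?_⟩
  have hE := Real.exp_pos E
  have h1 : (0 : ℝ) < 1 + Real.exp E := by positivity
  have hm : Real.exp E / (1 + Real.exp E) ∈ Set.Icc (0 : ℝ) 1 :=
    ⟨by positivity, by rw [div_le_one h1]; linarith⟩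
  have := hmin hm
  simp only [Set.mem_ofPred_eq] at this
  calc _ ≤ ‖((Real.exp E / (1 + Real.exp E) : ℝ) : ℂ) +
        (1 - Real.exp E / (1 + Real.exp E) : ℝ) * μ‖ * (1 + Real.exp E) := by gcongr
    _ = ‖exp E + μ‖ := by
      have h2 : ‖((1 + Real.exp E : ℝ) : ℂ)‖ = 1 + Real.exp E := by
        rw [norm_real, Real.norm_of_nonneg h1.le]
      conv_lhs => arg 2; rw [← h2]
      rw [← norm_mul]
      congr 1
      have h1' : (1 : ℂ) + exp E ≠ 0 := by
        rw [← ofReal_exp]; exact_mod_cast h1.ne'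
      push_cast
      field_simp
      ring

theorem exp_add_ne_zero (hμ : μ ∈ slitPlane) (E : ℝ) : exp E + μ ≠ 0 := by
  obtain ⟨c, hc, h⟩ := exists_le_norm_exp_add hμ
  have := h E
  rw [← norm_pos_iff]
  have := Real.exp_pos E
  exact lt_of_lt_of_le (by positivity) (h E)

theorem kernelSymbol_eq (hμ : μ ∈ slitPlane) (E : ℝ) :
    kernelSymbol μ E = exp E / (exp E + μ) ^ 2 := by
  have := exp_add_ne_zero hμ E
  rw [kernelSymbol, resolventSymbol]
  field_simp
  ring

theorem kernelF_eq_kernelExt (hμ : μ ∈ slitPlane) (t : ℝ) : kernelF μ t = kernelExt μ t := by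
  rw [kernelF, kernelExt]
  congr 2
  ext E
  rw [kernelSymbol_eq hμ, ← mul_div_assoc, ← Complex.exp_add]
  congr 2
  ring

theorem hasDerivAt_resolventSymbol (hμ : μ ∈ slitPlane) (E : ℝ) :
    HasDerivAt (resolventSymbol μ) (-kernelSymbol μ E) E := by
  have h1 : HasDerivAt (fun E : ℝ => exp E + μ) (exp E) E := by
    simpa using ((Complex.hasDerivAt_exp (E : ℂ)).comp_ofReal).add_const μ
  have := h1.inv (exp_add_ne_zero hμ E)
  rw [kernelSymbol_eq hμ, ← neg_div]
  exact this

theorem hasDerivAt_kernelSymbol (hμ : μ ∈ slitPlane) (E : ℝ) :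
    HasDerivAt (kernelSymbol μ)
      (-kernelSymbol μ E * (1 - 2 * μ * resolventSymbol μ E)) E := by
  have h := hasDerivAt_resolventSymbol hμ E
  have := h.mul ((h.const_mul μ).const_sub 1)
  refine this.congr_deriv ?_
  ring

theorem hasDerivAt_deriv_kernelSymbol (hμ : μ ∈ slitPlane) (E : ℝ) :
    HasDerivAt (fun E => -kernelSymbol μ E * (1 - 2 * μ * resolventSymbol μ E))
      (kernelSymbol μ E * ((1 - 2 * μ * resolventSymbol μ E) ^ 2 - 2 * μ * kernelSymbol μ E)) E := by
  have h := hasDerivAt_resolventSymbol hμ E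
  have := (hasDerivAt_kernelSymbol hμ E).neg.mul ((h.const_mul (2 * μ)).const_sub 1)
  refine this.congr_deriv ?_
  simp only [Pi.neg_apply]
  ring

theorem continuous_resolventSymbol (hμ : μ ∈ slitPlane) : Continuous (resolventSymbol μ) :=
  continuous_iff_continuousAt.2 fun E => (hasDerivAt_resolventSymbol hμ E).continuousAt

theorem continuous_kernelSymbol (hμ : μ ∈ slitPlane) : Continuous (kernelSymbol μ) :=
  continuous_iff_continuousAt.2 fun E => (hasDerivAt_kernelSymbol hμ E).continuousAt

theorem exists_resolventSymbol_le (hμ : μ ∈ slitPlane) :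
    ∃ C : ℝ, 0 < C ∧ ∀ E, ‖resolventSymbol μ E‖ ≤ C * (1 + Real.exp E)⁻¹ := by
  obtain ⟨c, hc, h⟩ := exists_le_norm_exp_add hμ
  refine ⟨c⁻¹, by positivity, fun E => ?_⟩
  have hE := Real.exp_pos E
  rw [resolventSymbol, norm_inv, ← mul_inv]
  exact inv_anti₀ (by positivity) (h E)

/-- The symbol is e^E u², with u bounded by a multiple of 1/(1 + e^E), and e^E/(1 + e^E)² ≤ e^{-|E|}
on both half-lines. -/
theorem exists_kernelSymbol_le (hμ : μ ∈ slitPlane) :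
    ∃ C : ℝ, 0 < C ∧ ∀ E, ‖kernelSymbol μ E‖ ≤ C * Real.exp (-|E|) := by
  obtain ⟨C, hC, h⟩ := exists_resolventSymbol_le hμ
  refine ⟨C ^ 2, by positivity, fun E => ?_⟩
  have hE := Real.exp_pos E
  have h1 : kernelSymbol μ E = exp E * resolventSymbol μ E ^ 2 := by
    rw [kernelSymbol_eq hμ, resolventSymbol, inv_pow, div_eq_mul_inv]
  rw [h1, norm_mul, norm_pow, ← ofReal_exp, norm_real, Real.norm_of_nonneg hE.le]
  calc Real.exp E * ‖resolventSymbol μ E‖ ^ 2 ≤ Real.exp E * (C * (1 + Real.exp E)⁻¹) ^ 2 := by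
        gcongr; exact h E
    _ = C ^ 2 * (Real.exp E * ((1 + Real.exp E)⁻¹) ^ 2) := by ring
    _ ≤ _ := by
      gcongr
      rw [inv_pow, ← div_eq_mul_inv, div_le_iff₀ (by positivity)]
      rcases le_total 0 E with h0 | h0
      · rw [abs_of_nonneg h0, Real.exp_neg, inv_mul_eq_div, le_div_iff₀ hE]
        nlinarith
      · rw [abs_of_nonpos h0, neg_neg]
        nlinarith [sq_nonneg (Real.exp E)]

/-- The first two derivatives of g are g times polynomials in the bounded functions u and g, so they
inherit the decay of g. -/
theorem exists_kernelSymbol_deriv2_le (hμ : μ ∈ slitPlane) :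
    ∃ C : ℝ, 0 < C ∧ ∀ E, ‖kernelSymbol μ E‖ ≤ C * Real.exp (-|E|) ∧
      ‖-kernelSymbol μ E * (1 - 2 * μ * resolventSymbol μ E)‖ ≤ C * Real.exp (-|E|) ∧
      ‖kernelSymbol μ E * ((1 - 2 * μ * resolventSymbol μ E) ^ 2 - 2 * μ * kernelSymbol μ E)‖
        ≤ C * Real.exp (-|E|) := by
  obtain ⟨C, hC, h⟩ := exists_resolventSymbol_le hμ
  obtain ⟨D, hD, h'⟩ := exists_kernelSymbol_le hμ
  have hu : ∀ E, ‖resolventSymbol μ E‖ ≤ C := fun E => (h E).trans (by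
    have hE := Real.exp_pos E
    exact mul_le_of_le_one_right hC.le (inv_le_one_of_one_le₀ (by linarith)))
  have hg : ∀ E, ‖kernelSymbol μ E‖ ≤ D := fun E => (h' E).trans
    (mul_le_of_le_one_right hD.le (Real.exp_le_one_iff.2 (by simp)))
  set M := 1 + 2 * ‖μ‖ * C with hM
  have hM1 : 1 ≤ M := by
    have : 0 ≤ 2 * ‖μ‖ * C := by positivity
    linarith
  have h1 : ∀ E, ‖1 - 2 * μ * resolventSymbol μ E‖ ≤ M := fun E => by
    refine (norm_sub_le _ _).trans ?_
    rw [norm_one, norm_mul, norm_mul]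
    simp only [Complex.norm_ofNat]
    have := hu E
    rw [hM]
    gcongr
  have h2 : ∀ E, ‖(1 - 2 * μ * resolventSymbol μ E) ^ 2 - 2 * μ * kernelSymbol μ E‖
      ≤ M ^ 2 + 2 * ‖μ‖ * D := fun E => by
    refine (norm_sub_le _ _).trans ?_
    rw [norm_pow, norm_mul, norm_mul]
    simp only [Complex.norm_ofNat]
    have := h1 E
    have := hg E
    gcongr
  set N := M ^ 2 + 2 * ‖μ‖ * D with hN
  have hN0 : M ≤ N := by
    have : 0 ≤ 2 * ‖μ‖ * D := by positivity
    nlinarith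
  refine ⟨D * N, by nlinarith, fun E => ?_⟩
  have hE := Real.exp_pos (-|E|)
  have key : ∀ z : ℂ, ‖z‖ ≤ N → ‖kernelSymbol μ E‖ * ‖z‖ ≤ D * N * Real.exp (-|E|) :=
    fun z hz => by
      calc _ ≤ D * Real.exp (-|E|) * N := by gcongr; exact h' E
        _ = _ := by ring
  refine ⟨?_, ?_, ?_⟩
  · simpa using key 1 (by simpa using hM1.trans hN0)
  · rw [norm_mul, norm_neg]
    exact key _ ((h1 E).trans hN0)
  · rw [norm_mul]
    exact key _ (h2 E)

theorem norm_exp_I_mul (ζ : ℂ) (E : ℝ) : ‖exp (I * ζ * E)‖ = Real.exp (-(ζ.im * E)) := by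
  rw [Complex.norm_exp]
  simp

theorem integral_exp_mul_deriv {ψ ψ' : ℝ → ℂ} (ζ : ℂ) (hd : ∀ E, HasDerivAt ψ (ψ' E) E)
    (h : Integrable fun E : ℝ => exp (I * ζ * E) * ψ E)
    (h' : Integrable fun E : ℝ => exp (I * ζ * E) * ψ' E) :
    ∫ E : ℝ, exp (I * ζ * E) * ψ' E = -(I * ζ) * ∫ E : ℝ, exp (I * ζ * E) * ψ E := by
  have he : ∀ E : ℝ, HasDerivAt (fun E : ℝ => exp (I * ζ * E)) (I * ζ * exp (I * ζ * E)) E := by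
    intro E
    have := (((hasDerivAt_id (E : ℂ)).const_mul (I * ζ)).cexp).comp_ofReal
    simpa [mul_comm] using this
  have := integral_mul_deriv_eq_deriv_mul_of_integrable (fun E _ => he E) (fun E _ => hd E)
    (by exact h') (by simpa [Pi.mul_def, mul_assoc] using h.const_mul (I * ζ)) (by exact h)
  rw [this, ← integral_const_mul, ← integral_neg]
  congr 1
  ext E
  ring

theorem norm_exp_mul_le {ζ z : ℂ} {b C E : ℝ} (hζ : |ζ.im| ≤ b)
    (hz : ‖z‖ ≤ C * Real.exp (-|E|)) :
    ‖exp (I * ζ * E) * z‖ ≤ C * Real.exp (-((1 - b) * |E|)) := by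
  rw [norm_mul, norm_exp_I_mul]
  have h1 : Real.exp (-(ζ.im * E)) ≤ Real.exp (b * |E|) := by
    apply Real.exp_le_exp.2
    calc -(ζ.im * E) ≤ |ζ.im * E| := neg_le_abs _
      _ ≤ _ := by rw [abs_mul]; gcongr
  calc _ ≤ Real.exp (b * |E|) * (C * Real.exp (-|E|)) := by gcongr
    _ = C * (Real.exp (b * |E|) * Real.exp (-|E|)) := by ring
    _ = _ := by rw [← Real.exp_add]; congr 2; ring

theorem integrable_exp_mul {ψ : ℝ → ℂ} (hc : Continuous ψ) {C : ℝ}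
    (h : ∀ E, ‖ψ E‖ ≤ C * Real.exp (-|E|)) {ζ : ℂ} (hζ : |ζ.im| < 1) :
    Integrable fun E : ℝ => exp (I * ζ * E) * ψ E :=
  ((integrable_exp_neg_mul_abs (sub_pos.2 hζ)).const_mul C).mono'
    (Continuous.aestronglyMeasurable (by fun_prop))
    (Filter.Eventually.of_forall fun E => norm_exp_mul_le le_rfl (h E))

/-- Decay of the kernel on closed substrips. -/
theorem exists_kernelExt_le (hμ : μ ∈ slitPlane) {b : ℝ} (hb : b < 1) :
    ∃ C : ℝ, 0 ≤ C ∧ ∀ ζ : ℂ, |ζ.im| ≤ b → ‖kernelExt μ ζ‖ ≤ C * (1 + ‖ζ‖ ^ 2)⁻¹ := by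
  obtain ⟨C, hC, h⟩ := exists_kernelSymbol_deriv2_le hμ
  set J := ∫ E : ℝ, C * Real.exp (-((1 - b) * |E|)) with hJ
  have hJi := (integrable_exp_neg_mul_abs (sub_pos.2 hb)).const_mul C
  have hJ0 : 0 ≤ J := integral_nonneg fun E => by positivity
  refine ⟨2 * J, by positivity, fun ζ hζ => ?_⟩
  have hζ1 : |ζ.im| < 1 := hζ.trans_lt hb
  have hc0 := continuous_kernelSymbol hμ
  have hcu := continuous_resolventSymbol hμ
  have hi0 := integrable_exp_mul hc0 (fun E => (h E).1) hζ1
  have hi1 := integrable_exp_mul (by fun_prop) (fun E => (h E).2.1) hζ1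
  have hi2 := integrable_exp_mul (by fun_prop) (fun E => (h E).2.2) hζ1
  -- Each integration by parts brings out a factor -iζ; two of them give the quadratic decay.
  have e1 := integral_exp_mul_deriv ζ (hasDerivAt_kernelSymbol hμ) hi0 hi1
  have e2 := integral_exp_mul_deriv ζ (hasDerivAt_deriv_kernelSymbol hμ) hi1 hi2
  rw [e1] at e2
  have b0 : ‖∫ E : ℝ, exp (I * ζ * E) * kernelSymbol μ E‖ ≤ J :=
    norm_integral_le_of_norm_le hJi
      (Filter.Eventually.of_forall fun E => norm_exp_mul_le hζ (h E).1)
  have b2 : ‖∫ E : ℝ, exp (I * ζ * E) * (kernelSymbol μ E *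
      ((1 - 2 * μ * resolventSymbol μ E) ^ 2 - 2 * μ * kernelSymbol μ E))‖ ≤ J :=
    norm_integral_le_of_norm_le hJi
      (Filter.Eventually.of_forall fun E => norm_exp_mul_le hζ (h E).2.2)
  rw [e2] at b2
  set A := ∫ E : ℝ, exp (I * ζ * E) * kernelSymbol μ E with hA
  have b2' : ‖ζ‖ ^ 2 * ‖A‖ ≤ J := by
    simpa [norm_mul, sq, mul_assoc] using b2
  have hpi : ‖(1 / (2 * Real.pi) : ℂ)‖ ≤ 1 := by
    rw [norm_div, norm_mul, norm_real, Real.norm_of_nonneg Real.pi_pos.le]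
    simp only [norm_one, Complex.norm_ofNat]
    rw [div_le_one (by positivity)]
    linarith [Real.pi_gt_three]
  rw [kernelExt, norm_mul, ← div_eq_mul_inv, le_div_iff₀ (by positivity)]
  calc _ ≤ 1 * ‖A‖ * (1 + ‖ζ‖ ^ 2) := by gcongr
    _ = ‖A‖ + ‖ζ‖ ^ 2 * ‖A‖ := by ring
    _ ≤ _ := by linarith

/-- The symbol u decays like e^{-E} at +∞ but is only bounded at -∞; the exponential weight must
supply decay at -∞ without destroying it at +∞. -/
theorem integrable_exp_mul_resolventSymbol (hμ : μ ∈ slitPlane) {ζ : ℂ} (h1 : -1 < ζ.im)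
    (h0 : ζ.im < 0) : Integrable fun E : ℝ => exp (I * ζ * E) * resolventSymbol μ E := by
  obtain ⟨C, hC, h⟩ := exists_resolventSymbol_le hμ
  have hcu := continuous_resolventSymbol hμ
  refine ((integrable_exp_neg_mul_abs (δ := min (-ζ.im) (1 + ζ.im))
    (lt_min (by linarith) (by linarith))).const_mul C).mono'
    (Continuous.aestronglyMeasurable (by fun_prop)) (Filter.Eventually.of_forall fun E => ?_)
  have hE := Real.exp_pos E
  rw [norm_mul, norm_exp_I_mul]
  calc _ ≤ Real.exp (-(ζ.im * E)) * (C * (1 + Real.exp E)⁻¹) := by gcongr; exact h E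
    _ = C * (Real.exp (-(ζ.im * E)) * (1 + Real.exp E)⁻¹) := by ring
    _ ≤ _ := by
      gcongr
      rcases le_total 0 E with h0 | h0
      · calc _ ≤ Real.exp (-(ζ.im * E)) * (Real.exp E)⁻¹ := by gcongr; linarith
          _ = Real.exp (-((1 + ζ.im) * E)) := by
            rw [← Real.exp_neg, ← Real.exp_add]; congr 1; ring
          _ ≤ _ := by
            rw [abs_of_nonneg h0]
            gcongr
            exact min_le_right _ _
      · calc _ ≤ Real.exp (-(ζ.im * E)) * 1 := by
              gcongr; exact inv_le_one_of_one_le₀ (by linarith)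
          _ = Real.exp (-(-ζ.im * -E)) := by rw [mul_one]; congr 1; ring
          _ ≤ _ := by
            rw [abs_of_nonpos h0]
            have : 0 ≤ -E := by linarith
            gcongr
            exact min_le_left _ _

theorem integrable_exp_mul_kernelSymbol (hμ : μ ∈ slitPlane) {ζ : ℂ} (hζ : |ζ.im| < 1) :
    Integrable fun E : ℝ => exp (I * ζ * E) * kernelSymbol μ E := by
  obtain ⟨C, hC, h⟩ := exists_kernelSymbol_le hμ
  exact integrable_exp_mul (continuous_kernelSymbol hμ) h hζ

/-- One integration by parts, since g = -u'. -/
theorem kernelExt_eq_mul_resolventKernel (hμ : μ ∈ slitPlane) {ζ : ℂ} (h1 : -1 < ζ.im)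
    (h0 : ζ.im < 0) : kernelExt μ ζ = I * ζ * resolventKernel μ ζ := by
  have hi := integrable_exp_mul_kernelSymbol hμ (ζ := ζ) (abs_lt.2 ⟨h1, by linarith⟩)
  have := integral_exp_mul_deriv ζ (hasDerivAt_resolventSymbol hμ)
    (integrable_exp_mul_resolventSymbol hμ h1 h0) (by simpa using hi.neg)
  simp only [mul_neg, integral_neg] at this
  rw [kernelExt, resolventKernel, neg_inj.1 (this.trans (neg_mul _ _))]
  ring

/-- Shifting ζ by i multiplies the integrand by e^{-E}, and g(E)(1 + μe^{-E}) = u(E). -/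
theorem kernelExt_add_mul_kernelExt (hμ : μ ∈ slitPlane) {ζ : ℂ} (h1 : -1 < ζ.im)
    (h0 : ζ.im < 0) : kernelExt μ ζ + μ * kernelExt μ (ζ + I) = resolventKernel μ ζ := by
  have hi := integrable_exp_mul_kernelSymbol hμ (ζ := ζ) (abs_lt.2 ⟨h1, by linarith⟩)
  have hi' := integrable_exp_mul_kernelSymbol hμ (ζ := ζ + I)
    (abs_lt.2 ⟨by simp; linarith, by simpa using h0⟩)
  rw [kernelExt, kernelExt, resolventKernel, mul_left_comm, ← mul_add, ← integral_const_mul,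
    ← integral_add hi (hi'.const_mul μ)]
  congr 2
  ext E
  have hne := exp_add_ne_zero hμ E
  have : exp (I * (ζ + I) * E) = exp (I * ζ * E) * (exp E)⁻¹ := by
    rw [← Complex.exp_neg, ← Complex.exp_add]
    congr 1
    linear_combination (E : ℂ) * I_mul_I
  have hE := Complex.exp_ne_zero (E : ℂ)
  rw [this, kernelSymbol_eq hμ, resolventSymbol]
  field_simp

/-- Eliminating k(ζ - i) from the two preceding relations at ζ - i expresses k above the real axis
through r below it. -/
theorem kernelExt_eq_shift (hμ : μ ∈ slitPlane) {ζ : ℂ} (h1 : 0 < ζ.im) (h0 : ζ.im < 1) :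
    μ * kernelExt μ ζ = -(I * ζ * resolventKernel μ (ζ - I)) := by
  have a1 : -1 < (ζ - I).im := by simp; linarith
  have a0 : (ζ - I).im < 0 := by simp; linarith
  have e := kernelExt_add_mul_kernelExt hμ a1 a0
  rw [kernelExt_eq_mul_resolventKernel hμ a1 a0, sub_add_cancel] at e
  linear_combination e + resolventKernel μ (ζ - I) * I_mul_I

end Kernel

/-! ### Holomorphy of parameter integrals and of the extended kernel -/

section Holomorphy

/-- Holomorphic dependence of an integral on a parameter, under local domination. -/
theorem differentiableOn_integral_of_dominated {α : Type*} [MeasurableSpace α] {ν : Measure α}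
    {k : ℂ → α → ℂ} {Ω : Set ℂ} (hΩ : IsOpen Ω) (hk : ∀ a, DifferentiableOn ℂ (k · a) Ω)
    (hm : ∀ w ∈ Ω, AEStronglyMeasurable (k w) ν)
    (hdom : ∀ w ∈ Ω, ∃ bound : α → ℝ, Integrable bound ν ∧
      ∀ᶠ z in 𝓝 w, ∀ a, ‖k z a‖ ≤ bound a) :
    DifferentiableOn ℂ (fun w => ∫ a, k w a ∂ν) Ω := by
  intro w hw
  obtain ⟨bound, hb, hev⟩ := hdom w hw
  obtain ⟨r, hr, hball⟩ := Metric.eventually_nhds_iff_ball.1 (hev.and (hΩ.mem_nhds hw))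
  have hsub : Metric.ball w r ⊆ Ω := fun z hz => (hball z hz).2
  have hder : ∀ a, ∀ z ∈ Metric.ball w (r / 2), HasDerivAt (k · a) (deriv (k · a) z) z :=
    fun a z hz => ((hk a).differentiableAt (hΩ.mem_nhds (hsub
      (Metric.ball_subset_ball (by linarith) hz)))).hasDerivAt
  refine DifferentiableAt.differentiableWithinAt ?_
  -- The derivative is measurable in `a` as a limit of difference quotients along a sequence.
  have hmw' : AEStronglyMeasurable (fun a => deriv (k · a) w) ν := by
    have hseq : Filter.Tendsto (fun n : ℕ => ((r / 2 / (n + 1) : ℝ) : ℂ)) Filter.atTop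
        (𝓝[≠] 0) := by
      refine tendsto_nhdsWithin_iff.2 ⟨?_, Filter.Eventually.of_forall fun n => ?_⟩
      · have := (tendsto_one_div_add_atTop_nhds_zero_nat (𝕜 := ℝ)).const_mul (r / 2)
        rw [mul_zero] at this
        have h2 := (Complex.continuous_ofReal.tendsto 0).comp this
        simpa [Function.comp_def, div_eq_mul_inv] using h2
      · have : r / 2 / ((n : ℝ) + 1) ≠ 0 := by positivity
        exact ofReal_ne_zero.2 this
    refine aestronglyMeasurable_of_tendsto_ae Filter.atTop
      (f := fun (n : ℕ) a => ((r / 2 / (n + 1) : ℝ) : ℂ)⁻¹ •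
        (k (w + ((r / 2 / (n + 1) : ℝ) : ℂ)) a - k w a)) (fun n => ?_)
      (Filter.Eventually.of_forall fun a => ?_)
    · refine ((hm (w + ((r / 2 / (n + 1) : ℝ) : ℂ)) (hsub ?_)).sub (hm w hw)).const_smul
        ((r / 2 / (n + 1) : ℝ) : ℂ)⁻¹
      have hp : 0 < r / 2 / ((n : ℝ) + 1) := by positivity
      have hle : r / 2 / ((n : ℝ) + 1) ≤ r / 2 := div_le_self (by linarith) (by simp)
      rw [Metric.mem_ball, dist_eq_norm, add_sub_cancel_left, norm_real,
        Real.norm_of_nonneg hp.le]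
      linarith
    · exact (hasDerivAt_iff_tendsto_slope_zero.1
        (hder a w (Metric.mem_ball_self (by linarith)))).comp hseq
  refine (hasDerivAt_integral_of_dominated_loc_of_deriv_le (F := k) (μ := ν) (x₀ := w)
    (F' := fun z a => deriv (k · a) z) (s := Metric.ball w (r / 2))
    (bound := fun a => bound a / (r / 2)) (Metric.ball_mem_nhds _ (by linarith)) ?_ ?_ hmw'
    (Filter.Eventually.of_forall fun a z hz => ?_) (hb.div_const _)
    (Filter.Eventually.of_forall hder)).2.differentiableAt
  · exact Filter.eventually_of_mem (hΩ.mem_nhds hw) hm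
  · exact hb.mono' (hm w hw)
      (Filter.Eventually.of_forall fun a => (hball w (Metric.mem_ball_self hr)).1 a)
  -- Cauchy's estimate on circles of radius r/2 bounds the derivative by `bound a / (r / 2)`.
  · have hcl : Metric.closedBall z (r / 2) ⊆ Metric.ball w r := fun y hy => by
      rw [Metric.mem_ball] at hz ⊢
      rw [Metric.mem_closedBall] at hy
      linarith [dist_triangle y z w]
    refine Complex.norm_deriv_le_of_forall_mem_sphere_norm_le (by linarith) ?_ fun y hy =>
      (hball y (hcl (Metric.sphere_subset_closedBall hy))).1 a
    refine DifferentiableOn.diffContOnCl ?_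
    rw [closure_ball _ (by linarith : r / 2 ≠ 0)]
    exact (hk a).mono (hcl.trans hsub)

theorem isOpen_abs_im_lt (b : ℝ) : IsOpen {ζ : ℂ | |ζ.im| < b} :=
  isOpen_lt (by fun_prop) continuous_const

variable {μ : ℂ}

theorem differentiableOn_kernelExt (hμ : μ ∈ slitPlane) :
    DifferentiableOn ℂ (kernelExt μ) {ζ | |ζ.im| < 1} := by
  obtain ⟨C, hC, h⟩ := exists_kernelSymbol_le hμ
  have hc := continuous_kernelSymbol hμ
  refine DifferentiableOn.const_mul (differentiableOn_integral_of_dominated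
    (k := fun ζ (E : ℝ) => exp (I * ζ * E) * kernelSymbol μ E) (isOpen_abs_im_lt 1)
    (fun E => ?_) (fun ζ _ => ?_) (fun ζ hζ => ?_)) _
  · fun_prop
  · exact Continuous.aestronglyMeasurable (by fun_prop)
  · obtain ⟨b, hb1, hb2⟩ := exists_between (show |ζ.im| < 1 from hζ)
    refine ⟨_, (integrable_exp_neg_mul_abs (sub_pos.2 hb2)).const_mul C, ?_⟩
    filter_upwards [(isOpen_abs_im_lt b).mem_nhds hb1] with z hz E
    exact norm_exp_mul_le (le_of_lt hz) (h E)

end Holomorphy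

/-! ### Integrability on horizontal lines and normalisation of the kernel -/

section ScalarIdentity

variable {μ : ℂ}

theorem continuous_kernelExt_line (hμ : μ ∈ slitPlane) {w : ℂ} (hw : |w.im| < 1) :
    Continuous fun t : ℝ => kernelExt μ (t - w) := by
  refine (differentiableOn_kernelExt hμ).continuousOn.comp_continuous (by fun_prop) fun t => ?_
  simpa using hw

theorem inv_one_add_sq_norm_sub_le (w : ℂ) (t : ℝ) :
    (1 + ‖(t : ℂ) - w‖ ^ 2)⁻¹ ≤ (1 + (t - w.re) ^ 2)⁻¹ := by
  have : (t - w.re) ^ 2 ≤ ‖(t : ℂ) - w‖ ^ 2 := by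
    rw [← sq_abs]
    gcongr
    simpa using Complex.abs_re_le_norm ((t : ℂ) - w)
  gcongr

theorem integrable_inv_one_add_sq_sub (a : ℝ) : Integrable fun t : ℝ => (1 + (t - a) ^ 2)⁻¹ :=
  integrable_inv_one_add_sq.comp_sub_right a

theorem integrable_kernelExt (hμ : μ ∈ slitPlane) {w : ℂ} (hw : |w.im| < 1) :
    Integrable fun t : ℝ => kernelExt μ (t - w) := by
  obtain ⟨C, hC, h⟩ := exists_kernelExt_le hμ hw
  refine ((integrable_inv_one_add_sq_sub w.re).const_mul C).mono'
    (continuous_kernelExt_line hμ hw).aestronglyMeasurable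
    (Filter.Eventually.of_forall fun t => (h _ (by simp)).trans
      (mul_le_mul_of_nonneg_left (inv_one_add_sq_norm_sub_le w t) hC))

theorem resolventKernel_sub (hμ : μ ∈ slitPlane) {w : ℂ} (h0 : 0 < w.im) (h1 : w.im < 1)
    (t : ℝ) : resolventKernel μ (t - w) = kernelExt μ (t - w) + μ * kernelExt μ (t - (w - I)) := by
  rw [← kernelExt_add_mul_kernelExt hμ (by simpa using h1) (by simpa using h0)]
  congr 3
  ring

theorem integrable_resolventKernel (hμ : μ ∈ slitPlane) {w : ℂ} (h0 : 0 < w.im) (h1 : w.im < 1) :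
    Integrable fun t : ℝ => resolventKernel μ (t - w) := by
  simp_rw [resolventKernel_sub hμ h0 h1]
  refine (integrable_kernelExt hμ (abs_lt.2 ⟨by linarith, h1⟩)).add
    ((integrable_kernelExt hμ (abs_lt.2 ⟨?_, ?_⟩)).const_mul μ)
  · simpa using h0
  · simp; linarith

/-- Fourier inversion at E = 0 for e^{-iwE}u(E), whose value there is 1/(1 + μ). This is the Cauchy
formula for the constant function 1. -/
theorem mul_integral_resolventKernel (hμ : μ ∈ slitPlane) {w : ℂ} (h0 : 0 < w.im)
    (h1 : w.im < 1) : (1 + μ) * ∫ t : ℝ, resolventKernel μ (t - w) = 1 := by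
  have hne : (1 : ℂ) + μ ≠ 0 := by simpa using exp_add_ne_zero hμ 0
  have hcu := continuous_resolventSymbol hμ
  set f : ℝ → ℂ := fun E => exp (I * (-w) * E) * resolventSymbol μ E with hf
  have hfi : Integrable f :=
    integrable_exp_mul_resolventSymbol hμ (by simpa using h1) (by simpa using h0)
  have hfc : Continuous f := by fun_prop
  have hF : ∀ ξ : ℝ, FourierTransform.fourier f ξ
      = 2 * Real.pi * resolventKernel μ ((-(2 * Real.pi) * ξ : ℝ) - w) := by
    intro ξ
    rw [Real.fourier_real_eq_integral_exp_smul, resolventKernel, ← mul_assoc, mul_one_div,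
      div_self (by simp [Real.pi_ne_zero]), one_mul]
    congr 1
    ext E
    rw [smul_eq_mul, hf, ← mul_assoc, ← Complex.exp_add]
    congr 2
    push_cast
    ring
  have hKi := integrable_resolventKernel hμ h0 h1
  have hpi : -(2 * Real.pi) ≠ 0 := by simp [Real.pi_ne_zero]
  have hFi : Integrable (FourierTransform.fourier f) := by
    have := (hKi.comp_mul_left' hpi).const_mul (2 * Real.pi : ℂ)
    refine this.congr (Filter.Eventually.of_forall fun ξ => ?_)
    exact (hF ξ).symm
  have := congr_fun (hfc.fourierInv_fourier_eq hfi hFi) 0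
  rw [Real.fourierInv_eq'] at this
  simp only [inner_zero_right, mul_zero, ofReal_zero, zero_mul, Complex.exp_zero, one_smul, hF,
    integral_const_mul] at this
  rw [Measure.integral_comp_mul_left (fun t : ℝ => resolventKernel μ (t - w))] at this
  simp only [hf, ofReal_zero, mul_zero, Complex.exp_zero, one_mul, resolventSymbol, abs_inv,
    abs_neg, abs_of_pos Real.two_pi_pos] at this
  rw [Complex.real_smul, ← mul_assoc] at this
  push_cast at this
  rw [mul_inv_cancel₀ (by simp [Real.pi_ne_zero]), one_mul] at this
  rw [this, mul_inv_cancel₀ hne]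

end ScalarIdentity

/-! ### Contour shift and the Cauchy formula for the strip -/

section Contour

/-- A contour shift across the strip `0 ≤ Im ζ ≤ 1` for functions that decay horizontally. -/
theorem integral_add_I_eq_of_decay {k : ℂ → ℂ}
    (hc : ContinuousOn k {ζ | 0 ≤ ζ.im ∧ ζ.im ≤ 1})
    (hd : DifferentiableOn ℂ k {ζ | 0 < ζ.im ∧ ζ.im < 1})
    {C a : ℝ} (hk : ∀ ζ : ℂ, 0 ≤ ζ.im → ζ.im ≤ 1 → ‖k ζ‖ ≤ C * (1 + (ζ.re - a) ^ 2)⁻¹) :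
    ∫ t : ℝ, k t = ∫ t : ℝ, k (t + I) := by
  have hline : ∀ y ∈ Set.Icc (0 : ℝ) 1, Continuous fun t : ℝ => k (t + y * I) := fun y hy =>
    hc.comp_continuous (by fun_prop) fun t => by simpa using hy
  have hint : ∀ y ∈ Set.Icc (0 : ℝ) 1, Integrable fun t : ℝ => k (t + y * I) := fun y hy =>
    ((integrable_inv_one_add_sq_sub a).const_mul C).mono' (hline y hy).aestronglyMeasurable
      (Filter.Eventually.of_forall fun t => by
        simpa using hk (t + y * I) (by simpa using hy.1) (by simpa using hy.2))
  have hrect : ∀ R : ℝ, 0 < R → (∫ x : ℝ in -R..R, k x) - (∫ x : ℝ in -R..R, k (x + I)) =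
      I * (∫ y : ℝ in 0..1, k (-R + y * I)) - I * (∫ y : ℝ in 0..1, k (R + y * I)) := by
    intro R hR
    have := integral_boundary_rect_eq_zero_of_continuousOn_of_differentiableOn k
      ((-R : ℝ) : ℂ) (R + I) (hc.mono ?_) (hd.mono ?_)
    · simp only [ofReal_re, ofReal_im, add_re, add_im, neg_re, neg_im, neg_zero, I_re, I_im,
        ofReal_zero, zero_mul, add_zero, zero_add, ofReal_one, one_mul, smul_eq_mul,
        ofReal_neg] at this
      linear_combination this
    · intro ζ hζ
      simpa [mem_reProdIm] using hζ.2
    · intro ζ hζ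
      simpa [mem_reProdIm] using hζ.2
  -- The vertical sides vanish in the limit; s will be R ↦ -R and R ↦ R.
  have hvert : ∀ s : ℝ → ℝ, Filter.Tendsto (fun R => (s R - a) ^ 2) Filter.atTop Filter.atTop →
      Filter.Tendsto (fun R : ℝ => I * ∫ y : ℝ in 0..1, k (s R + y * I)) Filter.atTop (𝓝 0) := by
    intro s hs
    rw [← mul_zero I]
    refine Filter.Tendsto.const_mul I ?_
    refine squeeze_zero_norm (a := fun R => C * (1 + (s R - a) ^ 2)⁻¹) (fun R => ?_) ?_
    · refine (intervalIntegral.norm_integral_le_of_norm_le_const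
        (C := C * (1 + (s R - a) ^ 2)⁻¹) fun y hy => ?_).trans (by simp)
      rw [Set.uIoc_of_le zero_le_one] at hy
      simpa using hk (s R + y * I) (by simpa using hy.1.le) (by simpa using hy.2)
    · rw [← mul_zero C]
      exact (tendsto_inv_atTop_zero.comp
        (Filter.tendsto_atTop_add_const_left _ 1 hs)).const_mul C
  have hsq : Filter.Tendsto (fun x : ℝ => x ^ 2) Filter.atTop Filter.atTop :=
    Filter.tendsto_pow_atTop (by norm_num)
  have hv1 := hvert (fun R => -R) (by
    have := hsq.comp (Filter.tendsto_atTop_add_const_right _ a Filter.tendsto_id)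
    refine this.congr fun R => ?_
    simp only [Function.comp_apply, id]
    ring)
  have hv2 := hvert (fun R => R) (hsq.comp
    (Filter.tendsto_atTop_add_const_right _ (-a) Filter.tendsto_id))
  have h0 := hint 0 (by simp)
  have h1 := hint 1 (by simp)
  simp only [ofReal_zero, zero_mul, add_zero, ofReal_one, one_mul] at h0 h1
  have hl0 := intervalIntegral_tendsto_integral h0 Filter.tendsto_neg_atTop_atBot
    Filter.tendsto_id
  have hl1 := intervalIntegral_tendsto_integral h1 Filter.tendsto_neg_atTop_atBot
    Filter.tendsto_id
  have hl := hl0.sub hl1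
  have hr := hv1.sub hv2
  rw [sub_zero] at hr
  refine sub_eq_zero.1 (tendsto_nhds_unique (hl.congr' ?_) hr)
  filter_upwards [Filter.eventually_gt_atTop 0] with R hR
  simpa using hrect R hR

variable {μ : ℂ}

/-- The values of a bounded holomorphic function inside the strip, in terms of its boundary
values. -/
theorem integral_resolventKernel_mul_eq (hμ : μ ∈ slitPlane) {f : ℂ → ℂ}
    (hc : ContinuousOn f {ζ | 0 ≤ ζ.im ∧ ζ.im ≤ 1})
    (hd : DifferentiableOn ℂ f {ζ | 0 < ζ.im ∧ ζ.im < 1})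
    {M : ℝ} (hM : ∀ ζ : ℂ, 0 ≤ ζ.im → ζ.im ≤ 1 → ‖f ζ‖ ≤ M)
    {w : ℂ} (h0 : 0 < w.im) (h1 : w.im < 1) :
    ∫ t : ℝ, resolventKernel μ (t - w) * (μ * f t + f (t + I)) = f w := by
  have hopen : IsOpen {ζ : ℂ | 0 < ζ.im ∧ ζ.im < 1} :=
    (isOpen_lt continuous_const Complex.continuous_im).inter
      (isOpen_lt Complex.continuous_im continuous_const)
  have hw : {ζ : ℂ | 0 < ζ.im ∧ ζ.im < 1} ∈ 𝓝 w := hopen.mem_nhds ⟨h0, h1⟩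
  have hw' : {ζ : ℂ | 0 ≤ ζ.im ∧ ζ.im ≤ 1} ∈ 𝓝 w :=
    Filter.mem_of_superset hw fun ζ hζ => ⟨hζ.1.le, hζ.2.le⟩
  -- Instead of taking a residue at w, the contour is shifted for k(ζ - w) times the divided
  -- difference of f, which is holomorphic at w.
  have hdsc : ContinuousOn (dslope f w) {ζ | 0 ≤ ζ.im ∧ ζ.im ≤ 1} :=
    (continuousOn_dslope hw').2 ⟨hc, hd.differentiableAt hw⟩
  have hdsd : DifferentiableOn ℂ (dslope f w) {ζ | 0 < ζ.im ∧ ζ.im < 1} :=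
    (Complex.differentiableOn_dslope hw).2 hd
  -- a bound of the divided difference
  obtain ⟨D, hD⟩ : ∃ D, ∀ ζ : ℂ, 0 ≤ ζ.im → ζ.im ≤ 1 → ‖dslope f w ζ‖ ≤ D := by
    obtain ⟨D, hD⟩ := ((isCompact_Icc (a := w.re - 1) (b := w.re + 1)).reProdIm
      (isCompact_Icc (a := (0 : ℝ)) (b := 1))).exists_bound_of_continuousOn
      (hdsc.mono fun ζ hζ => hζ.2)
    refine ⟨max D (2 * M), fun ζ hζ0 hζ1 => ?_⟩
    by_cases hre : |ζ.re - w.re| ≤ 1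
    · refine (hD ζ ⟨?_, hζ0, hζ1⟩).trans (le_max_left _ _)
      have := abs_le.1 hre
      exact ⟨by linarith, by linarith⟩
    · refine le_trans ?_ (le_max_right _ _)
      have hge : 1 ≤ ‖ζ - w‖ := (not_le.1 hre).le.trans (by
        simpa using Complex.abs_re_le_norm (ζ - w))
      have hne : ζ ≠ w := by
        rintro rfl
        simp at hge
        linarith
      rw [dslope_of_ne _ hne, slope_def_module, norm_smul, norm_inv]
      calc _ ≤ 1 * (M + M) := by
            gcongr
            · exact inv_le_one_of_one_le₀ hge
            · exact (norm_sub_le _ _).trans (add_le_add (hM _ hζ0 hζ1) (hM _ h0.le h1.le))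
        _ = _ := by ring
  have hD0 : 0 ≤ D := (norm_nonneg _).trans (hD w h0.le h1.le)
  -- the kernel on the strip
  have him : ∀ ζ : ℂ, 0 ≤ ζ.im → ζ.im ≤ 1 → |(ζ - w).im| ≤ max w.im (1 - w.im) := by
    intro ζ hζ0 hζ1
    rw [sub_im, abs_le]
    constructor
    · linarith [le_max_left w.im (1 - w.im)]
    · linarith [le_max_right w.im (1 - w.im)]
  have hb : max w.im (1 - w.im) < 1 := max_lt h1 (by linarith)
  obtain ⟨C, hC, hbound⟩ := exists_kernelExt_le hμ hb
  have hkd : DifferentiableOn ℂ (fun ζ => kernelExt μ (ζ - w)) {ζ | 0 ≤ ζ.im ∧ ζ.im ≤ 1} :=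
    (differentiableOn_kernelExt hμ).comp (by fun_prop)
      fun ζ hζ => (him ζ hζ.1 hζ.2).trans_lt hb
  have key := integral_add_I_eq_of_decay
    (k := fun ζ => kernelExt μ (ζ - w) * dslope f w ζ) (C := C * D) (a := w.re)
    (hkd.continuousOn.mul hdsc) ((hkd.mono fun ζ hζ => ⟨hζ.1.le, hζ.2.le⟩).mul hdsd)
    (fun ζ hζ0 hζ1 => by
      rw [norm_mul]
      have e1 := hbound _ (him ζ hζ0 hζ1)
      have e2 := hD ζ hζ0 hζ1
      have e3 : (1 + ‖ζ - w‖ ^ 2)⁻¹ ≤ (1 + (ζ.re - w.re) ^ 2)⁻¹ := by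
        have : (ζ.re - w.re) ^ 2 ≤ ‖ζ - w‖ ^ 2 := by
          rw [← sq_abs]
          gcongr
          simpa using Complex.abs_re_le_norm (ζ - w)
        gcongr
      calc _ ≤ (C * (1 + (ζ.re - w.re) ^ 2)⁻¹) * D := by
            gcongr
            exact e1.trans (by gcongr)
        _ = _ := by ring)
  have hμ0 := slitPlane_ne_zero hμ
  -- On each edge the factor ζ - w contained in k cancels the denominator of the divided difference.
  have hlow : ∀ t : ℝ, kernelExt μ (t - w) * dslope f w t
      = I * (resolventKernel μ (t - w) * (f t - f w)) := by
    intro t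
    have hne : (t : ℂ) ≠ w := by rintro rfl; simp at h0
    have hne' := sub_ne_zero.2 hne
    rw [kernelExt_eq_mul_resolventKernel hμ (by simpa using h1) (by simpa using h0),
      dslope_of_ne _ hne, slope_def_field]
    field_simp
  have hupp : ∀ t : ℝ, kernelExt μ (t + I - w) * dslope f w (t + I)
      = -(I * (resolventKernel μ (t - w) * (f (t + I) - f w))) / μ := by
    intro t
    have hne : (t : ℂ) + I ≠ w := by
      rintro rfl
      simp at h1
    have hne' := sub_ne_zero.2 hne
    have e := kernelExt_eq_shift hμ (ζ := t + I - w) (by simpa using h1) (by simpa using h0)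
    rw [show (t : ℂ) + I - w - I = t - w by ring] at e
    rw [eq_div_iff hμ0, mul_right_comm, mul_comm (kernelExt _ _), e, dslope_of_ne _ hne,
      slope_def_field]
    field_simp
  have hK := integrable_resolventKernel hμ h0 h1
  have hline0 : Continuous fun t : ℝ => f t :=
    hc.comp_continuous (by fun_prop) fun t => by simp
  have hline1 : Continuous fun t : ℝ => f (t + I) :=
    hc.comp_continuous (by fun_prop) fun t => by simp
  have hi0 : Integrable fun t : ℝ => resolventKernel μ (t - w) * f t :=
    hK.mul_bdd hline0.aestronglyMeasurable
      (Filter.Eventually.of_forall fun t => hM t (by simp) (by simp))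
  have hi1 : Integrable fun t : ℝ => resolventKernel μ (t - w) * f (t + I) :=
    hK.mul_bdd hline1.aestronglyMeasurable
      (Filter.Eventually.of_forall fun t => hM (t + I) (by simp) (by simp))
  have hiw := hK.mul_const (f w)
  simp only [hlow, hupp, mul_sub] at key
  rw [integral_sub (hi0.const_mul I) (hiw.const_mul I), integral_div, integral_neg,
    integral_sub (hi1.const_mul I) (hiw.const_mul I)] at key
  simp only [integral_const_mul, integral_mul_const] at key
  have hone := mul_integral_resolventKernel hμ h0 h1
  have hsplit : ∫ t : ℝ, resolventKernel μ (t - w) * (μ * f t + f (t + I))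
      = μ * (∫ t : ℝ, resolventKernel μ (t - w) * f t)
        + ∫ t : ℝ, resolventKernel μ (t - w) * f (t + I) := by
    rw [← integral_const_mul, ← integral_add (hi0.const_mul μ) hi1]
    congr 1
    ext t
    ring
  rw [hsplit]
  rw [eq_div_iff hμ0] at key
  refine mul_left_cancel₀ I_ne_zero ?_
  linear_combination key + I * f w * hone

end Contour

/-! ### Duality: transposes, weak holomorphy, uniform boundedness -/

section WeakTopology

variable {X F : Type*} [NormedAddCommGroup X] [NormedSpace ℂ X]
  [NormedAddCommGroup F] [NormedSpace ℂ F] {B : X →ₗ[ℂ] F →ₗ[ℂ] ℂ}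

theorem IsDualPair.flip (hB : IsDualPair B) : IsDualPair B.flip :=
  ⟨hB.norm_right, hB.norm_left⟩

theorem IsDualPair.norm_le (hB : IsDualPair B) {x : X} {M : ℝ} (hM : 0 ≤ M)
    (h : ∀ φ, ‖B x φ‖ ≤ M * ‖φ‖) : ‖x‖ ≤ M :=
  (hB.norm_left x).2 (by
    rintro r ⟨φ, hφ, rfl⟩
    exact (h φ).trans (mul_le_of_le_one_right hM hφ))

theorem IsDualPair.ext (hB : IsDualPair B) {x y : X} (h : ∀ φ, B x φ = B y φ) : x = y :=
  sub_eq_zero.1 (hB.eq_zero fun φ => by rw [map_sub, LinearMap.sub_apply, h, sub_self])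

/-- The pairing with `φ` as a continuous functional on the Banach space `X`. -/
noncomputable def IsDualPair.evalCLM (hB : IsDualPair B) (φ : F) : X →L[ℂ] ℂ :=
  (B.flip φ).mkContinuous ‖φ‖ (hB.norm_pairing_le φ)

theorem IsDualPair.evalCLM_apply (hB : IsDualPair B) (φ : F) (x : X) :
    hB.evalCLM φ x = B x φ := rfl

theorem continuous_pairing (B : X →ₗ[ℂ] F →ₗ[ℂ] ℂ) (φ : F) :
    Continuous[weakTopology B, inferInstance] fun x => B x φ :=
  WeakBilin.eval_continuous B φ

theorem continuous_weak_of_pairing {α : Type*} [TopologicalSpace α] {f : α → X}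
    (h : ∀ φ, Continuous fun a => B (f a) φ) : Continuous[inferInstance, weakTopology B] f :=
  WeakBilin.continuous_of_continuous_eval B h

theorem continuousOn_weak_of_pairing {α : Type*} [TopologicalSpace α] {f : α → X} {s : Set α}
    (h : ∀ φ, ContinuousOn (fun a => B (f a) φ) s) :
    @ContinuousOn α X _ (weakTopology B) f s :=
  (@continuousOn_iff_continuous_domRestrict α X _ (weakTopology B) f s).2
    (continuous_weak_of_pairing fun φ => continuousOn_iff_continuous_domRestrict.1 (h φ))

/-- A `σ(X, F)`-continuous operator has a transpose on `F`. -/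
theorem exists_transpose (T : X →L[ℂ] X) (hT : Continuous[weakTopology B, weakTopology B] T)
    (φ : F) : ∃ ψ : F, ∀ x, B (T x) φ = B x ψ := by
  let g : WeakBilin B →ₗ[ℂ] ℂ := (B.flip φ).comp (T : X →ₗ[ℂ] X)
  have hg : Continuous g :=
    @Continuous.comp X X ℂ (weakTopology B) (weakTopology B) _ T (fun x => B x φ)
      (continuous_pairing B φ) hT
  obtain ⟨ψ, hψ⟩ := LinearMap.dualEmbedding_surjective B ⟨g, hg⟩
  exact ⟨ψ, fun x => (DFunLike.congr_fun hψ x).symm⟩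

/-- Weakly holomorphic, locally bounded functions are holomorphic for the norm. -/
theorem differentiableOn_of_pairing [CompleteSpace X] (hB : IsDualPair B) {f : ℂ → X} {Ω : Set ℂ}
    (hΩ : IsOpen Ω) (hf : ∀ φ, DifferentiableOn ℂ (fun w => B (f w) φ) Ω)
    (hb : ∀ w ∈ Ω, ∃ M, ∀ᶠ z in 𝓝 w, ‖f z‖ ≤ M) : DifferentiableOn ℂ f Ω := by
  have hcont : ContinuousOn f Ω := by
    intro c hc
    refine ContinuousAt.continuousWithinAt ?_
    obtain ⟨M, hM⟩ := hb c hc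
    obtain ⟨r, hr, hball⟩ := Metric.eventually_nhds_iff_ball.1 (hM.and (hΩ.mem_nhds hc))
    have hM0 : 0 ≤ M := (norm_nonneg _).trans (hball c (Metric.mem_ball_self hr)).1
    -- The Schwarz lemma for each scalar function gives a Lipschitz bound proportional to ‖φ‖, hence
    -- a norm bound.
    have hlip : ∀ z ∈ Metric.ball c r, ‖f z - f c‖ ≤ 2 * M / r * dist z c := fun z hz => by
      refine hB.norm_le (by positivity) fun φ => ?_
      have hmaps : Set.MapsTo (fun w => B (f w) φ) (Metric.ball c r)
          (Metric.closedBall (B (f c) φ) (2 * M * ‖φ‖)) := fun y hy => by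
        rw [Metric.mem_closedBall, dist_eq_norm, ← LinearMap.sub_apply, ← map_sub]
        refine (hB.norm_pairing_le φ _).trans ?_
        rw [mul_comm]
        gcongr
        refine (norm_sub_le _ _).trans ?_
        linarith [(hball y hy).1, (hball c (Metric.mem_ball_self hr)).1]
      have := Complex.dist_le_div_mul_dist_of_mapsTo_ball
        ((hf φ).mono fun y hy => (hball y hy).2) hmaps hz
      rw [dist_eq_norm, ← LinearMap.sub_apply, ← map_sub] at this
      refine this.trans_eq ?_
      ring
    refine tendsto_iff_norm_sub_tendsto_zero.2 (squeeze_zero' (g := fun z => 2 * M / r * dist z c)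
      (Filter.Eventually.of_forall fun z => norm_nonneg _) ?_ ?_)
    · filter_upwards [Metric.ball_mem_nhds c hr] with z hz using hlip z hz
    · have : Continuous fun z => 2 * M / r * dist z c := by fun_prop
      simpa using this.tendsto c
  intro c hc
  refine DifferentiableAt.differentiableWithinAt ?_
  obtain ⟨r, hr, hsub⟩ := Metric.nhds_basis_closedBall.mem_iff.1 (hΩ.mem_nhds hc)
  lift r to NNReal using hr.le
  have hsph : ContinuousOn f (Metric.sphere c r) :=
    hcont.mono (Metric.sphere_subset_closedBall.trans hsub)
  have hci : CircleIntegrable f c r := hsph.circleIntegrable r.2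
  -- The Cauchy integral of the norm continuous f is analytic in norm; testing against each φ
  -- identifies it with f.
  have han := (hasFPowerSeriesOn_cauchy_integral hci (by exact_mod_cast hr)).analyticAt
  refine han.differentiableAt.congr_of_eventuallyEq ?_
  filter_upwards [Metric.ball_mem_nhds c hr] with w hw
  refine hB.ext fun φ => ?_
  have hwi : CircleIntegrable (fun z => (z - w)⁻¹ • f z) c r := by
    refine ContinuousOn.circleIntegrable r.2 (ContinuousOn.smul (ContinuousOn.inv₀ (by fun_prop)
      fun z hz h0 => ?_) hsph)
    rw [sub_eq_zero.1 h0, Metric.mem_sphere] at hz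
    rw [Metric.mem_ball] at hw
    linarith
  have hcauchy := ((hf φ).mono hsub).circleIntegral_sub_inv_smul hw
  have hcomm : B (∮ z in C(c, r), (z - w)⁻¹ • f z) φ
      = ∮ z in C(c, r), (z - w)⁻¹ • B (f z) φ := by
    rw [circleIntegral, circleIntegral, ← hB.evalCLM_apply φ,
      ← (hB.evalCLM φ).intervalIntegral_comp_comm hwi.out]
    simp only [map_smul, hB.evalCLM_apply, LinearMap.smul_apply]
  have h2pi : (2 * Real.pi * I : ℂ) ≠ 0 := by simp [Real.pi_ne_zero, I_ne_zero]
  rw [map_smul, LinearMap.smul_apply, hcomm, hcauchy, smul_eq_mul, smul_eq_mul,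
    inv_mul_cancel_left₀ h2pi]

/-- Pointwise boundedness against `F` implies boundedness in norm. -/
theorem exists_norm_le_of_pairing [CompleteSpace F] (hB : IsDualPair B) {ι : Type*} {f : ι → X}
    (h : ∀ φ, ∃ C, ∀ i, ‖B (f i) φ‖ ≤ C) : ∃ M, ∀ i, ‖f i‖ ≤ M := by
  obtain ⟨M, hM⟩ := banach_steinhaus (g := fun i => hB.flip.evalCLM (f i)) h
  refine ⟨max M 0, fun i => hB.norm_le (le_max_right _ _) fun φ => ?_⟩
  exact ((hB.flip.evalCLM (f i)).le_of_opNorm_le (hM i) φ).trans (by gcongr; exact le_max_left _ _)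

end WeakTopology

/-! ### Existence of weak integrals -/

section WeakIntegral

variable {X F : Type*} [NormedAddCommGroup X] [NormedSpace ℂ X]
  [NormedAddCommGroup F] [NormedSpace ℂ F] {B : X →ₗ[ℂ] F →ₗ[ℂ] ℂ}

/-- Weak integrals over compact intervals exist under the Krein property. -/
theorem KreinProperty.exists_setIntegral (hK : KreinProperty B) {c : ℝ → X}
    (hc : ∀ φ, Continuous fun t => B (c t) φ) {a b : ℝ} (hab : a < b) :
    ∃ y : X, ∀ φ, B y φ = ∫ t in Set.Icc a b, B (c t) φ := by
  let _ : TopologicalSpace X := weakTopology B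
  have hKc : IsCompact (c '' Set.Icc a b) :=
    isCompact_Icc.image (continuous_weak_of_pairing hc)
  have hC := hK _ hKc
  set A := closure (convexHull ℝ (c '' Set.Icc a b)) with hA
  have hvol : volume.real (Set.Icc a b) = b - a := by simp [measureReal_def, hab.le]
  have hba : (b - a) ≠ 0 := (sub_pos.2 hab).ne'
  set S : F → Set X := fun φ : F => {y : X | B y φ = (b - a)⁻¹ • ∫ t in Set.Icc a b, B (c t) φ} with hS
  -- The mean value is sought in the compact set A by the finite intersection property. For finitely
  -- many φ the problem is finite-dimensional: the mean of L ∘ c lies in the closed convex hull of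
  -- its values, which L(A), compact and hence closed, contains.
  have hne : ∀ u : Finset F, (A ∩ ⋂ φ ∈ u, S φ).Nonempty := by
    intro u
    let L : X →ₗ[ℂ] (u → ℂ) := LinearMap.pi fun φ => B.flip φ
    have hL : Continuous L := continuous_pi fun φ => continuous_pairing B φ
    have hcl : IsClosed (L '' A) := (hC.image hL).isClosed
    have hsub : closure (convexHull ℝ (L '' (c '' Set.Icc a b))) ⊆ L '' A := by
      refine closure_minimal ?_ hcl
      have := (L.restrictScalars ℝ).image_convexHull (c '' Set.Icc a b)
      rw [LinearMap.coe_restrictScalars] at this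
      rw [← this]
      exact Set.image_mono subset_closure
    have hLc : Continuous fun t => L (c t) := continuous_pi fun φ => hc φ
    have hint : IntegrableOn (fun t => L (c t)) (Set.Icc a b) :=
      hLc.continuousOn.integrableOn_compact isCompact_Icc
    have hmem := (convex_convexHull ℝ (L '' (c '' Set.Icc a b))).closure.set_average_mem
      isClosed_closure (μ := volume) (t := Set.Icc a b) (f := fun t => L (c t))
      (by simp [hab]) (by simp)
      ((ae_restrict_iff' measurableSet_Icc).2 (Filter.Eventually.of_forall fun t ht =>
        subset_closure (subset_convexHull ℝ _ ⟨_, ⟨t, ht, rfl⟩, rfl⟩))) hint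
    obtain ⟨y, hyA, hy⟩ := hsub hmem
    refine ⟨y, hyA, Set.mem_iInter₂.2 fun φ hφ => ?_⟩
    have h1 := congr_fun hy ⟨φ, hφ⟩
    rw [setAverage_eq, hvol, Pi.smul_apply] at h1
    have h2 := (ContinuousLinearMap.proj (R := ℂ) (φ := fun _ : u => ℂ)
      ⟨φ, hφ⟩).integral_comp_comm hint
    change B y φ = _
    exact h1.trans (congrArg (fun z => (b - a)⁻¹ • z) h2.symm)
  obtain ⟨y, -, hy⟩ := hC.inter_iInter_nonempty S
    (fun φ => isClosed_eq (continuous_pairing B φ) continuous_const) hne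
  refine ⟨(b - a) • y, fun φ => ?_⟩
  have : B y φ = _ := Set.mem_iInter.1 hy φ
  rw [← Complex.coe_smul, map_smul, LinearMap.smul_apply, this, Complex.coe_smul,
    smul_inv_smul₀ hba]

theorem integrable_smul_pairing (hB : IsDualPair B) {k : ℝ → ℂ} (hki : Integrable k) {c : ℝ → X}
    (hc : ∀ φ, Continuous fun t => B (c t) φ) {M : ℝ} (hM : ∀ t, ‖c t‖ ≤ M) (φ : F) :
    Integrable fun t => B (k t • c t) φ := by
  simp only [map_smul, LinearMap.smul_apply, smul_eq_mul]
  exact hki.mul_bdd (c := ‖φ‖ * M) (hc φ).aestronglyMeasurable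
    (Filter.Eventually.of_forall fun t => (hB.norm_pairing_le φ _).trans (by gcongr; exact hM t))

theorem norm_smul_pairing_le (hB : IsDualPair B) (k : ℝ → ℂ) {c : ℝ → X}
    {M : ℝ} (hM : ∀ t, ‖c t‖ ≤ M) (φ : F) (t : ℝ) :
    ‖B (k t • c t) φ‖ ≤ ‖k t‖ * (M * ‖φ‖) := by
  refine (hB.norm_pairing_le φ _).trans ?_
  rw [norm_smul]
  calc ‖φ‖ * (‖k t‖ * ‖c t‖) ≤ ‖φ‖ * (‖k t‖ * M) := by gcongr; exact hM t
    _ = _ := by ring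

theorem IsWeakIntegral.norm_le (hB : IsDualPair B) {k : ℝ → ℂ} (hki : Integrable k) {c : ℝ → X}
    {M : ℝ} (hM : ∀ t, ‖c t‖ ≤ M) {y : X} (hy : IsWeakIntegral B (fun t => k t • c t) y) :
    ‖y‖ ≤ (∫ t, ‖k t‖) * M := by
  have hM0 : 0 ≤ M := (norm_nonneg _).trans (hM 0)
  refine hB.norm_le (mul_nonneg (integral_nonneg fun t => norm_nonneg _) hM0) fun φ => ?_
  rw [(hy φ).2, mul_assoc, ← integral_mul_const]
  exact norm_integral_le_of_norm_le (hki.norm.mul_const _)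
    (Filter.Eventually.of_forall (norm_smul_pairing_le hB k hM φ))

/-- Weak integrals against integrable continuous kernels exist under the Krein property. -/
theorem KreinProperty.exists_isWeakIntegral [CompleteSpace X] (hB : IsDualPair B)
    (hK : KreinProperty B) {k : ℝ → ℂ} (hk : Continuous k) (hki : Integrable k) {c : ℝ → X}
    (hc : ∀ φ, Continuous fun t => B (c t) φ) {M : ℝ} (hM : ∀ t, ‖c t‖ ≤ M) :
    ∃ y : X, IsWeakIntegral B (fun t => k t • c t) y := by
  have hM0 : 0 ≤ M := (norm_nonneg _).trans (hM 0)
  have hkc : ∀ φ, Continuous fun t => B (k t • c t) φ := fun φ => by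
    simp only [map_smul, LinearMap.smul_apply, smul_eq_mul]
    exact hk.mul (hc φ)
  have hint := integrable_smul_pairing hB hki hc hM
  choose y hy using fun n : ℕ => hK.exists_setIntegral hkc
    (a := -((n : ℝ) + 1)) (b := (n : ℝ) + 1) (by linarith [n.cast_nonneg (α := ℝ)])
  set S : ℕ → Set ℝ := fun n => Set.Icc (-((n : ℝ) + 1)) ((n : ℝ) + 1) with hS
  have hn : Filter.Tendsto (fun n : ℕ => (n : ℝ) + 1) Filter.atTop Filter.atTop :=
    Filter.tendsto_atTop_add_const_right _ _ tendsto_natCast_atTop_atTop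
  have hcov : AECover (volume : Measure ℝ) Filter.atTop S :=
    aecover_Icc (Filter.tendsto_neg_atTop_atBot.comp hn) hn
  have hmono : ∀ {n m : ℕ}, n ≤ m → S n ⊆ S m := fun {n m} h => by
    have : (n : ℝ) ≤ m := by exact_mod_cast h
    exact Set.Icc_subset_Icc (by linarith) (by linarith)
  set J : ℕ → ℝ := fun n => ∫ t in S n, ‖k t‖ with hJ
  have hJlim : Filter.Tendsto J Filter.atTop (𝓝 (∫ t, ‖k t‖)) :=
    hcov.integral_tendsto_of_countably_generated hki.norm
  have hJle : ∀ n, J n ≤ ∫ t, ‖k t‖ := fun n =>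
    setIntegral_le_integral hki.norm (Filter.Eventually.of_forall fun t => norm_nonneg _)
  -- The truncated integrals are Cauchy in norm, their differences being controlled by the tails of
  -- ∫ ‖k‖.
  have hdiff : ∀ {n m : ℕ}, n ≤ m → ‖y m - y n‖ ≤ M * (J m - J n) := by
    intro n m h
    have hJd : J m - J n = ∫ t in S m \ S n, ‖k t‖ :=
      (setIntegral_sdiff measurableSet_Icc hki.norm.integrableOn (hmono h)).symm
    refine hB.norm_le (mul_nonneg hM0 (hJd ▸ integral_nonneg fun t => norm_nonneg _)) fun φ => ?_
    rw [map_sub, LinearMap.sub_apply, hy, hy,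
      ← setIntegral_sdiff measurableSet_Icc (hint φ).integrableOn (hmono h), hJd,
      show M * (∫ t in S m \ S n, ‖k t‖) * ‖φ‖ = (∫ t in S m \ S n, ‖k t‖) * (M * ‖φ‖) by ring,
      ← integral_mul_const]
    exact norm_integral_le_of_norm_le (hki.norm.mul_const _).integrableOn
      (Filter.Eventually.of_forall (norm_smul_pairing_le hB k hM φ))
  have hcs : CauchySeq y := by
    refine cauchySeq_of_le_tendsto_0 (fun N => 2 * (M * ((∫ t, ‖k t‖) - J N)))
      (fun n m N hn hm => ?_) ?_
    · have h1 := (hdiff hn).trans (mul_le_mul_of_nonneg_left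
        (sub_le_sub_right (hJle n) (J N)) hM0)
      have h2 := (hdiff hm).trans (mul_le_mul_of_nonneg_left
        (sub_le_sub_right (hJle m) (J N)) hM0)
      rw [← dist_eq_norm] at h1 h2
      have := dist_triangle_right (y n) (y m) (y N)
      linarith
    · have := ((hJlim.const_sub (∫ t, ‖k t‖)).const_mul M).const_mul 2
      simpa using this
  obtain ⟨z, hz⟩ := cauchySeq_tendsto_of_complete hcs
  refine ⟨z, fun φ => ⟨hint φ, ?_⟩⟩
  have h1 := ((hB.evalCLM φ).continuous.tendsto z).comp hz
  have h2 := hcov.integral_tendsto_of_countably_generated (hint φ)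
  refine tendsto_nhds_unique h1 (h2.congr fun n => ?_)
  exact (hy n φ).symm

end WeakIntegral

/-! ### The operators ∫ k(t) U_t dt -/

section IntegralOperator

variable {X F : Type*} [NormedAddCommGroup X] [NormedSpace ℂ X]
  [NormedAddCommGroup F] [NormedSpace ℂ F] {B : X →ₗ[ℂ] F →ₗ[ℂ] ℂ} {U : ℝ → X →L[ℂ] X}

theorem IsIsometryGroup.continuous_pairing_orbit (hU : IsIsometryGroup B U) (x : X) (φ : F) :
    Continuous fun t : ℝ => B (U t x) φ :=
  @Continuous.comp ℝ X ℂ _ (weakTopology B) _ (fun t => U t x) (fun x => B x φ)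
    (continuous_pairing B φ) (hU.continuous_orbit x)

theorem KreinProperty.exists_integralOperator [CompleteSpace X] (hB : IsDualPair B)
    (hK : KreinProperty B) (hU : IsIsometryGroup B U) {k : ℝ → ℂ} (hk : Continuous k)
    (hki : Integrable k) :
    ∃ Q : X →L[ℂ] X, ∀ x, IsWeakIntegral B (fun t => k t • U t x) (Q x) := by
  choose Q hQ using fun x => hK.exists_isWeakIntegral hB hk hki
    (hU.continuous_pairing_orbit x) (fun t => (hU.isometry t x).le)
  let L : X →ₗ[ℂ] X :=
    { toFun := Q
      map_add' := fun x y => hB.ext fun φ => by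
        rw [map_add, LinearMap.add_apply, (hQ _ φ).2, (hQ x φ).2, (hQ y φ).2,
          ← integral_add (hQ x φ).1 (hQ y φ).1]
        simp
      map_smul' := fun a x => hB.ext fun φ => by
        rw [RingHom.id_apply, map_smul, LinearMap.smul_apply, (hQ _ φ).2, (hQ x φ).2,
          ← integral_smul]
        simp [mul_left_comm] }
  exact ⟨L.mkContinuous _ fun x => (hQ x).norm_le hB hki fun t => (hU.isometry t x).le, hQ⟩

/-- Integrating the transposed orbit t ↦ U_t'φ weakly in F produces a transpose of Q at φ. That
orbit is bounded by ‖φ‖ because the U_t are isometries. -/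
theorem KreinProperty.continuous_integralOperator [CompleteSpace F] (hB : IsDualPair B)
    (hK : KreinProperty B.flip) (hU : IsIsometryGroup B U) {k : ℝ → ℂ} (hk : Continuous k)
    (hki : Integrable k) {Q : X → X}
    (hQ : ∀ x, IsWeakIntegral B (fun t => k t • U t x) (Q x)) :
    Continuous[weakTopology B, weakTopology B] Q := by
  refine @continuous_weak_of_pairing X F _ _ _ _ B X (weakTopology B) Q fun φ => ?_
  choose ψ hψ using fun t => exists_transpose (U t) (hU.weak_continuous t) φ
  obtain ⟨η, hη⟩ := hK.exists_isWeakIntegral hB.flip hk hki (c := ψ) (M := ‖φ‖)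
    (fun x => by
      simp only [LinearMap.flip_apply, ← hψ]
      exact hU.continuous_pairing_orbit x φ)
    (fun t => hB.flip.norm_le (norm_nonneg _) fun x => by
      rw [LinearMap.flip_apply, ← hψ]
      refine (hB.norm_pairing_le φ _).trans_eq ?_
      rw [hU.isometry])
  have : (fun x => B (Q x) φ) = fun x => B x η := by
    ext x
    have h := (hη x).2
    simp only [LinearMap.flip_apply, map_smul] at h
    rw [(hQ x φ).2, h]
    simp [hψ]
  rw [this]
  exact continuous_pairing B η

theorem IsWeakIntegral.map (hU : IsIsometryGroup B U) {k : ℝ → ℂ} {x y : X}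
    (hy : IsWeakIntegral B (fun t => k t • U t x) y) (s : ℝ) :
    IsWeakIntegral B (fun t => k (t - s) • U t x) (U s y) := by
  intro φ
  obtain ⟨ψ, hψ⟩ := exists_transpose (U s) (hU.weak_continuous s) φ
  have h : (fun t => B (k (t - s) • U t x) φ) = fun t => B (k (t - s) • U (t - s) x) ψ := by
    ext t
    rw [← hψ, (U s).map_smul, ← ContinuousLinearMap.comp_apply, ← hU.map_add, add_sub_cancel]
  rw [h, hψ, (hy ψ).2]
  exact ⟨(hy ψ).1.comp_sub_right s, (integral_sub_right_eq_self _ s).symm⟩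

end IntegralOperator

/-! ### Covariance and boundedness of strip extensions -/

section StripExtension

theorem strip_I : strip I = {w | 0 ≤ w.im ∧ w.im ≤ 1} := by
  ext w
  simp only [strip, I_im, mul_one, abs_one, Set.mem_ofPred_eq]
  exact and_congr_right fun h => by rw [abs_of_nonneg h]

theorem interior_strip_I : interior (strip I) = {w | 0 < w.im ∧ w.im < 1} := by
  rw [strip_I]
  change interior (Complex.im ⁻¹' Set.Icc 0 1) = Complex.im ⁻¹' Set.Ioo 0 1
  rw [Complex.interior_preimage_im, interior_Icc]

variable {X F : Type*} [NormedAddCommGroup X] [NormedSpace ℂ X]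
  [NormedAddCommGroup F] [NormedSpace ℂ F] {B : X →ₗ[ℂ] F →ₗ[ℂ] ℂ} {U : ℝ → X →L[ℂ] X}
  {x : X} {f : ℂ → X}

theorem IsStripExtension.continuousOn_pairing (hf : IsStripExtension B U I x f) (φ : F) :
    ContinuousOn (fun w => B (f w) φ) {w | 0 ≤ w.im ∧ w.im ≤ 1} := by
  rw [← strip_I]
  exact weakTopology_pairing_comp hf.continuousOn φ

theorem IsStripExtension.differentiableOn_pairing (hB : IsDualPair B)
    (hf : IsStripExtension B U I x f) (φ : F) :
    DifferentiableOn ℂ (fun w => B (f w) φ) {w | 0 < w.im ∧ w.im < 1} := by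
  rw [← interior_strip_I]
  exact (hB.evalCLM φ).differentiable.comp_differentiableOn hf.differentiableOn

/-- Both sides agree for real w by the group law, and uniqueness of continuation from the real axis
carries this to the strip. -/
theorem IsStripExtension.apply_add (hB : IsDualPair B) (hU : IsIsometryGroup B U)
    (hf : IsStripExtension B U I x f) (t : ℝ) {w : ℂ} (h0 : 0 ≤ w.im) (h1 : w.im ≤ 1) :
    f (w + t) = U t (f w) := by
  refine hB.ext fun φ => ?_
  obtain ⟨ψ, hψ⟩ := exists_transpose (U t) (hU.weak_continuous t) φ
  rw [hψ]
  have hreal : ∀ s : ℝ, B (f (s + t)) φ - B (f s) ψ = 0 := fun s => by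
    rw [← ofReal_add, hf.apply_ofReal, hf.apply_ofReal, ← hψ, ← ContinuousLinearMap.comp_apply,
      ← hU.map_add, add_comm, sub_self]
  rcases h0.eq_or_lt with h0 | h0
  · have : w = (w.re : ℂ) := Complex.ext (by simp) (by simp [← h0])
    rw [this]
    exact sub_eq_zero.1 (hreal _)
  refine sub_eq_zero.1 (eq_zero_of_strip (g := fun w => B (f (w + t)) φ - B (f w) ψ) h0
    (ContinuousOn.sub ?_ ?_) (DifferentiableOn.sub ?_ ?_) hreal rfl)
  · exact (hf.continuousOn_pairing φ).comp (by fun_prop) fun z hz => by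
      simpa using ⟨hz.1, hz.2.trans h1⟩
  · exact (hf.continuousOn_pairing ψ).mono fun z hz => ⟨hz.1, hz.2.trans h1⟩
  · exact (hf.differentiableOn_pairing hB φ).comp (by fun_prop) fun z hz => by
      simpa using ⟨hz.1, hz.2.trans_le h1⟩
  · exact (hf.differentiableOn_pairing hB ψ).mono fun z hz => ⟨hz.1, hz.2.trans_le h1⟩

/-- By covariance and isometry ‖f(w)‖ depends only on Im w. On the segment from 0 to i weak
continuity gives pointwise bounds, and uniform boundedness does the rest. -/
theorem IsStripExtension.exists_norm_le [CompleteSpace F] (hB : IsDualPair B)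
    (hU : IsIsometryGroup B U) (hf : IsStripExtension B U I x f) :
    ∃ M, ∀ w : ℂ, 0 ≤ w.im → w.im ≤ 1 → ‖f w‖ ≤ M := by
  obtain ⟨M, hM⟩ := exists_norm_le_of_pairing hB (f := fun y : Set.Icc (0 : ℝ) 1 => f (y * I))
    fun φ => by
      have hc : ContinuousOn (fun y : ℝ => B (f (y * I)) φ) (Set.Icc 0 1) :=
        (hf.continuousOn_pairing φ).comp (by fun_prop) fun y hy => by simpa using hy
      obtain ⟨C, hC⟩ := isCompact_Icc.exists_bound_of_continuousOn hc
      exact ⟨C, fun y => hC y y.2⟩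
  refine ⟨M, fun w h0 h1 => ?_⟩
  have := hf.apply_add hB hU w.re (w := w.im * I) (by simpa using h0) (by simpa using h1)
  rw [add_comm, re_add_im] at this
  rw [this, hU.isometry]
  exact hM ⟨w.im, h0, h1⟩

end StripExtension

/-! ### Smoothed orbits and the resolvent equation for U_i -/

section GraphResolvent

variable {μ : ℂ}

theorem differentiableOn_integral_kernelExt_mul (hμ : μ ∈ slitPlane) {g : ℝ → ℂ}
    (hg : Continuous g) {M : ℝ} (hM : ∀ t, ‖g t‖ ≤ M) :
    DifferentiableOn ℂ (fun w : ℂ => ∫ t : ℝ, kernelExt μ (t - w) * g t) {w | |w.im| < 1} := by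
  refine differentiableOn_integral_of_dominated (isOpen_abs_im_lt 1) (fun t => ?_) (fun w hw => ?_)
    fun w hw => ?_
  · refine DifferentiableOn.mul_const ((differentiableOn_kernelExt hμ).comp (by fun_prop)
      fun w hw => ?_) _
    simpa using hw
  · exact ((continuous_kernelExt_line hμ hw).mul hg).aestronglyMeasurable
  · obtain ⟨b, hb1, hb2⟩ := exists_between (show |w.im| < 1 from hw)
    obtain ⟨C, hC, h⟩ := exists_kernelExt_le hμ hb2
    -- The factor 3 absorbs the move from z to w: 1 + (a + b)² ≤ 3(1 + a²) when |b| ≤ 1.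
    refine ⟨_, ((integrable_inv_one_add_sq_sub w.re).const_mul (C * 3)).mul_const M, ?_⟩
    have hre : {z : ℂ | |z.re - w.re| < 1} ∈ 𝓝 w :=
      (isOpen_lt (by fun_prop) continuous_const).mem_nhds (by simp)
    filter_upwards [(isOpen_abs_im_lt b).mem_nhds hb1, hre] with z hz hz' t
    rw [norm_mul]
    refine mul_le_mul ?_ (hM t) (norm_nonneg _) (by positivity)
    refine (h _ (by simpa using le_of_lt hz)).trans ?_
    rw [mul_assoc]
    refine mul_le_mul_of_nonneg_left ((inv_one_add_sq_norm_sub_le z t).trans ?_) hC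
    rw [← div_eq_mul_inv, inv_eq_one_div, div_le_div_iff₀ (by positivity) (by positivity)]
    have := abs_lt.1 hz'
    nlinarith [sq_nonneg ((t - z.re) - (z.re - w.re)), sq_nonneg (t - z.re)]

theorem exists_integral_norm_kernelExt_le (hμ : μ ∈ slitPlane) {b : ℝ} (hb : b < 1) :
    ∃ C : ℝ, ∀ w : ℂ, |w.im| ≤ b → ∫ t : ℝ, ‖kernelExt μ (t - w)‖ ≤ C := by
  obtain ⟨C, hC, h⟩ := exists_kernelExt_le hμ hb
  refine ⟨C * ∫ t : ℝ, (1 + t ^ 2)⁻¹, fun w hw => ?_⟩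
  rw [← integral_sub_right_eq_self (fun t : ℝ => (1 + t ^ 2)⁻¹) w.re, ← integral_const_mul]
  refine integral_mono (integrable_kernelExt hμ (hw.trans_lt hb)).norm
    ((integrable_inv_one_add_sq_sub w.re).const_mul C) fun t => ?_
  exact (h _ (by simpa using hw)).trans
    (mul_le_mul_of_nonneg_left (inv_one_add_sq_norm_sub_le w t) hC)

variable {X F : Type*} [NormedAddCommGroup X] [NormedSpace ℂ X]
  [NormedAddCommGroup F] [NormedSpace ℂ F] {B : X →ₗ[ℂ] F →ₗ[ℂ] ℂ} {U : ℝ → X →L[ℂ] X}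

/-- Smoothing with the translated kernels gives a holomorphic extension of the orbit of `Q v`. -/
theorem exists_smoothed_orbit [CompleteSpace X] (hB : IsDualPair B) (hX : KreinProperty B)
    (hU : IsIsometryGroup B U) (hμ : μ ∈ slitPlane) {Q : X → X}
    (hQ : ∀ x, IsWeakIntegral B (fun t : ℝ => kernelF μ t • U t x) (Q x)) (v : X) :
    ∃ H : ℂ → X, DifferentiableOn ℂ H {w | |w.im| < 1} ∧ (∀ t : ℝ, H t = U t (Q v)) ∧
      ∀ w : ℂ, |w.im| < 1 → IsWeakIntegral B (fun t : ℝ => kernelExt μ (t - w) • U t v) (H w) := by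
  have hW : ∀ w : ℂ, |w.im| < 1 →
      ∃ y, IsWeakIntegral B (fun t : ℝ => kernelExt μ (t - w) • U t v) y := fun w hw =>
    hX.exists_isWeakIntegral hB (continuous_kernelExt_line hμ hw) (integrable_kernelExt hμ hw)
      (hU.continuous_pairing_orbit v) (fun t => (hU.isometry t v).le)
  choose! H hH using hW
  refine ⟨H, differentiableOn_of_pairing hB (isOpen_abs_im_lt 1) (fun φ => ?_) (fun w hw => ?_),
    fun s => hB.ext fun φ => ?_, hH⟩
  · refine (differentiableOn_integral_kernelExt_mul hμ (hU.continuous_pairing_orbit v φ)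
      (M := ‖φ‖ * ‖v‖) fun t => ?_).congr fun w hw => ?_
    · exact (hB.norm_pairing_le φ _).trans_eq (by rw [hU.isometry])
    · rw [(hH w hw φ).2]
      simp
  · obtain ⟨b, hb1, hb2⟩ := exists_between (show |w.im| < 1 from hw)
    obtain ⟨C, hC⟩ := exists_integral_norm_kernelExt_le hμ hb2
    refine ⟨C * ‖v‖, ?_⟩
    filter_upwards [(isOpen_abs_im_lt b).mem_nhds hb1] with z hz
    have hz1 := lt_trans hz hb2
    refine ((hH z hz1).norm_le hB (integrable_kernelExt hμ hz1)
      fun t => (hU.isometry t v).le).trans ?_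
    gcongr
    exact hC z (le_of_lt hz)
  · rw [(hH s (by simp) φ).2, ((hQ v).map hU s φ).2]
    simp only [kernelF_eq_kernelExt hμ, ofReal_sub]

/-- If `y = U_i x`, then `s = Q (μ x + y)` lies in the domain of `U_i` and
`U_i s + μ s = y`. -/
theorem mem_extensionGraph_resolvent [CompleteSpace X] [CompleteSpace F] (hB : IsDualPair B)
    (hX : KreinProperty B) (hU : IsIsometryGroup B U) (hμ : μ ∈ slitPlane) {Q : X → X}
    (hQ : ∀ x, IsWeakIntegral B (fun t : ℝ => kernelF μ t • U t x) (Q x)) {x y : X}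
    (hxy : (x, y) ∈ extensionGraph B U I) :
    (Q (μ • x + y), y - μ • Q (μ • x + y)) ∈ extensionGraph B U I := by
  obtain ⟨f, hf, hfI⟩ := hxy
  obtain ⟨M, hM⟩ := hf.exists_norm_le hB hU
  set v := μ • x + y with hv
  obtain ⟨H, hHd, hHr, hH⟩ := exists_smoothed_orbit hB hX hU hμ hQ v
  -- the two formulas for the extension agree inside the strip
  have hagree : ∀ w : ℂ, 0 < w.im → w.im < 1 → H w = f w - μ • H (w - I) := by
    intro w h0 h1
    have hw : |w.im| < 1 := abs_lt.2 ⟨by linarith, h1⟩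
    have hw' : |(w - I).im| < 1 := abs_lt.2 ⟨by simpa using h0, by simp; linarith⟩
    refine hB.ext fun φ => ?_
    rw [map_sub, LinearMap.sub_apply, map_smul, LinearMap.smul_apply, eq_sub_iff_add_eq,
      (hH w hw φ).2, (hH _ hw' φ).2, ← integral_smul]
    refine (integral_add (hH w hw φ).1 ((hH _ hw' φ).1.smul μ)).symm.trans ?_
    rw [← integral_resolventKernel_mul_eq hμ (hf.continuousOn_pairing φ)
        (hf.differentiableOn_pairing hB φ) (M := ‖φ‖ * M)
        (fun ζ hζ0 hζ1 => (hB.norm_pairing_le φ _).trans (by gcongr; exact hM ζ hζ0 hζ1)) h0 h1]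
    congr 1
    ext t
    have e1 : f (t + I) = U t y := by
      have := hf.apply_add hB hU t (w := I) (by simp) (by simp)
      rw [add_comm, this, hfI]
    rw [resolventKernel_sub hμ h0 h1, hf.apply_ofReal, e1, hv]
    simp only [Pi.smul_apply, map_add, map_smul, LinearMap.add_apply, LinearMap.smul_apply, smul_eq_mul]
    ring
  have hHφ : ∀ φ, ContinuousOn (fun w => B (H w) φ) {w | |w.im| < 1} := fun φ =>
    (hB.evalCLM φ).continuous.comp_continuousOn hHd.continuousOn
  classical
  -- H is defined only below Im w = 1; on the top edge w - i is real, so the second formula takes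
  -- over.
  refine ⟨fun w => if w.im < 1 then H w else f w - μ • H (w - I), ⟨?_, ?_, fun t => ?_⟩, ?_⟩
  · refine continuousOn_weak_of_pairing fun φ w hw => ?_
    rw [strip_I] at hw ⊢
    rcases hw.2.lt_or_eq with h1 | h1
    · have hw1 : |w.im| < 1 := abs_lt.2 ⟨by linarith [hw.1], h1⟩
      refine (((hHφ φ).continuousAt
        ((isOpen_abs_im_lt 1).mem_nhds hw1)).congr ?_).continuousWithinAt
      filter_upwards [(isOpen_abs_im_lt 1).mem_nhds hw1] with z hz
      rw [if_pos (abs_lt.1 hz).2]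
    · have hpos : {z : ℂ | 0 < z.im} ∈ 𝓝 w :=
        (isOpen_lt continuous_const Complex.continuous_im).mem_nhds (by simp [h1])
      have hw1 : |(w - I).im| < 1 := by simp [h1]
      have hHI : ContinuousAt (fun z => B (H (z - I)) φ) w :=
        ContinuousAt.comp (f := fun z : ℂ => z - I) (g := fun z => B (H z) φ)
          ((hHφ φ).continuousAt ((isOpen_abs_im_lt 1).mem_nhds hw1)) (by fun_prop)
      have hcont : ContinuousWithinAt (fun z => B (f z) φ - μ * B (H (z - I)) φ)
          {w | 0 ≤ w.im ∧ w.im ≤ 1} w :=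
        (hf.continuousOn_pairing φ w hw).sub
          ((continuousAt_const.mul hHI).continuousWithinAt)
      -- Near the top edge the glued function is given by the second formula alone, so its
      -- continuity there reduces to that of f and H.
      have heq : ∀ z : ℂ, 0 < z.im → B (if z.im < 1 then H z else f z - μ • H (z - I)) φ
          = B (f z) φ - μ * B (H (z - I)) φ := by
        intro z hz
        have : (if z.im < 1 then H z else f z - μ • H (z - I)) = f z - μ • H (z - I) := by
          split_ifs with hz1
          · exact hagree z hz hz1
          · rfl
        rw [this]
        simp
      refine hcont.congr_of_eventuallyEq ?_ (heq w (by simp [h1]))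
      filter_upwards [mem_nhdsWithin_of_mem_nhds hpos] with z hz using heq z hz
  · rw [interior_strip_I]
    refine (hHd.mono fun w hw => abs_lt.2 ⟨by linarith [hw.1], hw.2⟩).congr fun w hw => ?_
    rw [if_pos hw.2]
  · rw [if_pos (by simp), hHr]
  · have h0 := hHr 0
    rw [hU.map_zero, ofReal_zero] at h0
    simp [hfI, h0]

/-- `U_i + μ` is injective. -/
theorem eq_zero_of_mem_extensionGraph [CompleteSpace X] [CompleteSpace F] (hB : IsDualPair B)
    (hX : KreinProperty B) (hU : IsIsometryGroup B U) (hμ : μ ∈ slitPlane) {Q : X →L[ℂ] X}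
    (hQ : ∀ x, IsWeakIntegral B (fun t : ℝ => kernelF μ t • U t x) (Q x)) {d : X}
    (hd : (d, -(μ • d)) ∈ extensionGraph B U I) : d = 0 := by
  -- With x = d and y = -μd the vector μx + y vanishes, so (0, -μd) lies in the graph.
  have := mem_extensionGraph_resolvent hB hX hU hμ hQ hd
  rw [add_neg_cancel, map_zero, smul_zero, sub_zero] at this
  have h0 := extensionGraph_single_valued hB U I _ this rfl
  simpa [slitPlane_ne_zero hμ] using h0

/-- For p = (x, y) the matrix involves Q only through s = Q(μx + y), the vector solving (U_i + μ)s =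
y when p is in the graph. -/
theorem resolventMatrix_apply (hμ : μ ≠ 0) (Q : X →L[ℂ] X) (p : X × X) :
    resolventMatrix μ Q p =
      (μ⁻¹ • (p.1 - Q (μ • p.1 + p.2)), Q (μ • p.1 + p.2)) := by
  simp only [resolventMatrix, ContinuousLinearMap.prod_apply, ContinuousLinearMap.coprod_apply,
    add_apply, neg_apply, smul_apply,
    ContinuousLinearMap.id_apply, map_add, map_smul, smul_sub, smul_add, inv_smul_smul₀ hμ]
  congr 1
  abel

theorem continuous_resolventMatrix {Q : X →L[ℂ] X}
    (hQ : Continuous[weakTopology B, weakTopology B] Q) :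
    Continuous[weakTopologyProd B, weakTopologyProd B] (resolventMatrix μ Q) := by
  have h1 : ∀ φ, Continuous[weakTopologyProd B, inferInstance] fun p : X × X => B p.1 φ :=
    fun φ => @Continuous.comp _ _ _ (weakTopologyProd B) (weakTopology B) _ Prod.fst
      (fun x => B x φ) (continuous_pairing B φ)
      (@continuous_fst X X (weakTopology B) (weakTopology B))
  have h2 : ∀ φ, Continuous[weakTopologyProd B, inferInstance] fun p : X × X => B p.2 φ :=
    fun φ => @Continuous.comp _ _ _ (weakTopologyProd B) (weakTopology B) _ Prod.snd
      (fun x => B x φ) (continuous_pairing B φ)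
      (@continuous_snd X X (weakTopology B) (weakTopology B))
  have hQφ : ∀ φ, ∃ ψ, ∀ x, B (Q x) φ = B x ψ := exists_transpose Q hQ
  refine @Continuous.prodMk X X (X × X) (weakTopology B) (weakTopology B) (weakTopologyProd B)
    (fun p => (resolventMatrix μ Q p).1) (fun p => (resolventMatrix μ Q p).2) ?_ ?_
  all_goals
    refine @continuous_weak_of_pairing X F _ _ _ _ B (X × X) (weakTopologyProd B) _ fun φ => ?_
    obtain ⟨ψ, hψ⟩ := hQφ φ
    let _ := weakTopologyProd B
    have a1 := h1 φ
    have a2 := h2 φ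
    have b1 := h1 ψ
    have b2 := h2 ψ
    simp only [resolventMatrix, ContinuousLinearMap.prod_apply, ContinuousLinearMap.coprod_apply,
      add_apply, neg_apply,
      smul_apply, ContinuousLinearMap.id_apply, map_add, map_neg, map_smul,
      LinearMap.add_apply, LinearMap.neg_apply, LinearMap.smul_apply, hψ, smul_eq_mul]
    first
    | exact (b1.neg.add (a1.const_mul _)).add (b2.const_mul _).neg
    | exact (b1.const_mul _).add b2

theorem ampliation_apply_eq {T : X →ₗ.[ℂ] X} (p : (ampliation T).domain) {z : X}
    (hz : ((p : T.graph).1.2, z) ∈ T.graph) :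
    (ampliation T p : X × X) = ((p : T.graph).1.2, z) := by
  obtain ⟨a, ha, ha'⟩ := (LinearPMap.mem_graph_iff T).1 p.1.2
  obtain ⟨b, hb, hb'⟩ := (LinearPMap.mem_graph_iff T).1 hz
  have e1 : (⟨(p.1 : X × X).1, p.2.1⟩ : T.domain) = a := Subtype.ext ha.symm
  have e2 : (⟨(p.1 : X × X).2, p.2.2⟩ : T.domain) = b := Subtype.ext hb.symm
  change (T ⟨(p.1 : X × X).1, p.2.1⟩, T ⟨(p.1 : X × X).2, p.2.2⟩) = _
  rw [e1, e2, ha', hb']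

end GraphResolvent

end AnalyticGenerator

/-! ### The resolvent of the ampliation -/

theorem mainTheorem2 {X F : Type*}
    [NormedAddCommGroup X] [NormedSpace ℂ X] [CompleteSpace X]
    [NormedAddCommGroup F] [NormedSpace ℂ F] [CompleteSpace F]
    (B : X →ₗ[ℂ] F →ₗ[ℂ] ℂ) (hB : IsDualPair B)
    (hX : KreinProperty B) (hF : KreinProperty B.flip)
    (U : ℝ → X →L[ℂ] X) (hU : IsIsometryGroup B U)
    (μ : ℂ) (hμ : μ ∈ Complex.slitPlane) :
    ∃ (Q : X →L[ℂ] X)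
      (R : (analyticGenerator B U).graph →L[ℂ] (analyticGenerator B U).graph),
      -- `Q` is the integral of `F_μ(t) U_t`, and it is weakly continuous
      (∀ x : X, IsWeakIntegral B (fun t : ℝ => kernelF μ t • U t x) (Q x)) ∧
      Continuous[weakTopology B, weakTopology B] Q ∧
      -- `R` is the restriction of the operator matrix to the graph, and it is weakly continuous
      (∀ p : (analyticGenerator B U).graph, (R p : X × X) = resolventMatrix μ Q p) ∧
      Continuous[weakTopologySub B (analyticGenerator B U).graph,
        weakTopologySub B (analyticGenerator B U).graph] R ∧
      -- `R (Δ + μ) = id` on the domain of `Δ`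
      (∀ p : (ampliation (analyticGenerator B U)).domain,
        R (ampliation (analyticGenerator B U) p + μ • (p : (analyticGenerator B U).graph)) = p) ∧
      -- `R` maps the graph into the domain of `Δ`, and `(Δ + μ) R = id` on the graph
      (∀ p : (analyticGenerator B U).graph,
        ∃ h : R p ∈ (ampliation (analyticGenerator B U)).domain,
          ampliation (analyticGenerator B U) ⟨R p, h⟩ + μ • R p = p) := by
  have hμ0 : μ ≠ 0 := slitPlane_ne_zero hμ
  have hk : kernelF μ = fun t : ℝ => kernelExt μ (t - 0) := by
    ext t
    rw [kernelF_eq_kernelExt hμ, sub_zero]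
  have hkc : Continuous (kernelF μ) := hk ▸ continuous_kernelExt_line hμ (by simp)
  have hki : Integrable (kernelF μ) := hk ▸ integrable_kernelExt hμ (by simp)
  obtain ⟨Q, hQ⟩ := hX.exists_integralOperator hB hU hkc hki
  have hQc := hF.continuous_integralOperator hB hU hkc hki hQ
  set T := analyticGenerator B U with hT
  have hG : T.graph = extensionGraph B U I := graph_complexPower hB U I
  have hdom : ∀ {x y : X}, (x, y) ∈ T.graph → x ∈ T.domain := fun {x y} h => by
    obtain ⟨a, ha, -⟩ := (LinearPMap.mem_graph_iff T).1 h
    exact (show (a : X) = x from ha) ▸ a.2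
  have hres : ∀ p ∈ T.graph,
      (Q (μ • p.1 + p.2), p.2 - μ • Q (μ • p.1 + p.2)) ∈ T.graph := fun p hp => by
    rw [hG] at hp ⊢
    exact mem_extensionGraph_resolvent hB hX hU hμ hQ hp
  have hmaps : ∀ p ∈ T.graph, resolventMatrix μ Q p ∈ T.graph := fun p hp => by
    -- The image of p is μ⁻¹(p - (s, U_i s)), a combination of two elements of the graph.
    have := T.graph.smul_mem μ⁻¹ (T.graph.sub_mem hp (hres p hp))
    rw [resolventMatrix_apply hμ0]
    convert this using 1
    refine Prod.ext rfl ?_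
    simp [inv_smul_smul₀ hμ0]
  set R : T.graph →L[ℂ] T.graph :=
    ((resolventMatrix μ Q).comp T.graph.subtypeL).codRestrict T.graph fun p => hmaps p p.2 with hR
  have hRp : ∀ p : T.graph, (R p : X × X) = resolventMatrix μ Q p := fun p => rfl
  refine ⟨Q, R, hQ, hQc, hRp, ?_, fun p => ?_, fun p => ?_⟩
  · refine continuous_induced_rng.2 ?_
    exact @Continuous.comp _ _ _ (weakTopologySub B T.graph) (weakTopologyProd B)
      (weakTopologyProd B) Subtype.val (resolventMatrix μ Q) (continuous_resolventMatrix hQc)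
      continuous_induced_dom
  · obtain ⟨b, hb⟩ : ∃ b : T.domain, (b : X) = (p : T.graph).1.2 := ⟨⟨_, p.2.2⟩, rfl⟩
    have hz : ((p : T.graph).1.2, T b) ∈ T.graph := hb ▸ T.mem_graph b
    have hΔ := ampliation_apply_eq p hz
    obtain ⟨⟨⟨x, y⟩, hxy⟩, hp⟩ := p
    set q := ampliation T ⟨⟨(x, y), hxy⟩, hp⟩ + μ • (⟨(x, y), hxy⟩ : T.graph) with hq
    have hq' : (q : X × X) = (y + μ • x, T b + μ • y) := by
      rw [hq, Submodule.coe_add, hΔ]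
      rfl
    have h1 := hres q q.2
    rw [hq'] at h1
    set s := Q (μ • (y + μ • x) + (T b + μ • y)) with hs
    have hsy : s = y := by
      refine sub_eq_zero.1 (eq_zero_of_mem_extensionGraph hB hX hU hμ hQ ?_)
      rw [← hG]
      convert T.graph.sub_mem h1 hz using 1
      refine Prod.ext rfl ?_
      simp only [Prod.mk_sub_mk, smul_sub]
      abel
    refine Subtype.ext ?_
    rw [hRp, resolventMatrix_apply hμ0, hq']
    change (μ⁻¹ • (y + μ • x - s), s) = (x, y)
    rw [hsy, add_sub_cancel_left, inv_smul_smul₀ hμ0]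
  · have hs := hres p p.2
    have hr : (μ⁻¹ • (p.1.1 - Q (μ • p.1.1 + p.1.2)), Q (μ • p.1.1 + p.1.2)) ∈ T.graph := by
      rw [← resolventMatrix_apply hμ0]
      exact hmaps p p.2
    have hRe : (R p : X × X) = _ := (hRp p).trans (resolventMatrix_apply hμ0 Q p)
    have hmem : R p ∈ (ampliation T).domain := by
      refine ⟨?_, ?_⟩
      · rw [hRe]
        exact hdom hr
      · rw [hRe]
        exact hdom hs
    refine ⟨hmem, Subtype.ext ?_⟩
    -- With p = (x, y), applying Δ to (μ⁻¹(x - s), s) gives (s, U_i s) = (s, y - μs); adding μ times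
    -- the argument returns p.
    have hΔ := ampliation_apply_eq (T := T) ⟨R p, hmem⟩ (z := p.1.2 - μ • Q (μ • p.1.1 + p.1.2))
      (by rw [hRe]; exact hs)
    rw [Submodule.coe_add, hΔ, Submodule.coe_smul, hRe]
    refine Prod.ext ?_ ?_
    · simp [smul_inv_smul₀ hμ0]
    · simp
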